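/- Let $m>0$ (black hole mass), $\omega>0$ (frequency), and let $s,\ell$ be real numbers with $0\le s\le\ell$ (spin and angular momentum; in particular all integer and half-integer values are allowed). For $r\in(2m,\infty)$ let $$V(r)=\Bigl(1-\frac{2m}{r}\Bigr)\Bigl[\frac{\ell(\ell+1)}{r^2}+\frac{2m(1-s^2)}{r^3}\Bigr]$$ be the Regge–Wheeler potential, and let $r=r(r_*)$ be the inverse of the tortoise coordinate $r_*=r+2m\ln\frac{r-2m}{2m}$, which maps $(2m,\infty)$ bijectively onto $\mathbb R$. The greybody factor $T$ at frequency $\omega$ is the transmission probability of the equation $$\frac{d^2\psi}{dr_*^2}+\bigl[\omega^2-V(r(r_*))\bigr]\psi=0,\qquad r_*\in\mathbb R,$$ that is, $T=1/|\alpha|^2$, where $\psi$ is a solution with $\psi-\frac{e^{i\omega r_*}}{\sqrt\omega}\to0$ as $r_*\to+\infty$ and, for some $\alpha,\beta\in\mathbb C$ with $\alpha\ne0$, $\psi-\bigl(\alpha\frac{e^{i\omega r_*}}{\sqrt\omega}+\beta\frac{e^{-i\omega r_*}}{\sqrt\omega}\bigr)\to0$ as $r_*\to-\infty$. Then: (0)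 $V$ attains its maximum over $(2m,\infty)$ at exactly one point, and the greybody factor $T$ exists and is uniquely determined. Write $V_{\rm peak}=\sup_{r>2m}V(r)$. (1) $$T\ \ge\ \operatorname{sech}^2\left\{\frac{(\ell+1)^2+(\ell^2-s^2)}{8\omega m}\right\}.$$ (2) If $\omega^2>V_{\rm peak}$, then $$T\ \ge\ \frac{4\omega^2(\omega^2-V_{\rm peak})}{(2\omega^2-V_{\rm peak})^2}=1-\frac{V_{\rm peak}^2}{(2\omega^2-V_{\rm peak})^2}.$$ (3) If $s=1$, then the maximum of $V$ is at $r=3m$, $V_{\rm peak}=\frac{\ell(\ell+1)}{27m^2}$, and if $\omega^2>V_{\rm peak}$, then $$T\ \ge\ \frac{108\,\omega^2m^2\,[27\omega^2m^2-\ell(\ell+1)]}{[54\omega^2m^2-\ell(\ell+1)]^2}.$$ -/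

import Mathlib

open Filter Topology

/-- The tortoise coordinate `r_*(r) = r + 2m ln((r - 2m)/(2m))` on the exterior `r > 2m`. -/
noncomputable def tortoise (m r : ℝ) : ℝ :=
  r + 2 * m * Real.log ((r - 2 * m) / (2 * m))

/-- The area radius `r ∈ (2m, ∞)` as a function of the tortoise coordinate: the inverse of
`tortoise m` on `(2m, ∞)` (see `tortoise_bijOn` and `tortoise_areaRadius`). -/
noncomputable def areaRadius (m : ℝ) : ℝ → ℝ :=
  Function.invFunOn (tortoise m) (Set.Ioi (2 * m))

theorem tortoise_strictMonoOn {m : ℝ} (hm : 0 < m) :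
    StrictMonoOn (tortoise m) (Set.Ioi (2 * m)) := by
  intro a ha b hb hab
  have ha' : 2 * m < a := ha
  have h1 : 0 < (a - 2 * m) / (2 * m) := div_pos (by linarith) (by linarith)
  have h2 : (a - 2 * m) / (2 * m) < (b - 2 * m) / (2 * m) :=
    div_lt_div_of_pos_right (by linarith) (by linarith)
  have h3 := mul_lt_mul_of_pos_left (Real.log_lt_log h1 h2) (show 0 < 2 * m by linarith)
  unfold tortoise
  linarith

theorem tortoise_surjOn {m : ℝ} (hm : 0 < m) :
    Set.SurjOn (tortoise m) (Set.Ioi (2 * m)) Set.univ := by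
  have hcont : Continuous fun u : ℝ => 2 * m * (1 + Real.exp u) + 2 * m * u := by fun_prop
  have htop : Tendsto (fun u : ℝ => 2 * m * (1 + Real.exp u) + 2 * m * u) atTop atTop := by
    refine tendsto_atTop_mono (f := fun u : ℝ => 2 * m * u) (fun u => ?_)
      (tendsto_id.const_mul_atTop (by linarith))
    have := Real.exp_pos u
    have : 0 < 2 * m * (1 + Real.exp u) := by positivity
    linarith
  have hbot : Tendsto (fun u : ℝ => 2 * m * (1 + Real.exp u) + 2 * m * u) atBot atBot := by
    refine Tendsto.add_atBot (C := 2 * m * (1 + 0)) ?_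
      (tendsto_id.const_mul_atBot (by linarith))
    exact (tendsto_const_nhds.add Real.tendsto_exp_atBot).const_mul _
  intro x _
  obtain ⟨u, hu⟩ := hcont.surjective htop hbot x
  refine ⟨2 * m * (1 + Real.exp u), ?_, ?_⟩
  · have : 0 < 2 * m * Real.exp u := by positivity
    simp only [Set.mem_Ioi]
    linarith
  · have : (2 * m * (1 + Real.exp u) - 2 * m) / (2 * m) = Real.exp u := by
      field_simp
      ring
    rw [tortoise, this, Real.log_exp]
    exact hu

/-- The tortoise coordinate maps the exterior `(2m, ∞)` bijectively onto the real line. -/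
theorem tortoise_bijOn {m : ℝ} (hm : 0 < m) :
    Set.BijOn (tortoise m) (Set.Ioi (2 * m)) Set.univ :=
  ⟨Set.mapsTo_univ _ _, (tortoise_strictMonoOn hm).injOn, tortoise_surjOn hm⟩

theorem areaRadius_gt {m : ℝ} (hm : 0 < m) (x : ℝ) : 2 * m < areaRadius m x :=
  Function.invFunOn_mem (tortoise_surjOn hm (Set.mem_univ x))

theorem tortoise_areaRadius {m : ℝ} (hm : 0 < m) (x : ℝ) :
    tortoise m (areaRadius m x) = x :=
  Function.invFunOn_eq (tortoise_surjOn hm (Set.mem_univ x))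

/-- The Regge–Wheeler potential
`V(r) = (1 - 2m/r) [ℓ(ℓ+1)/r² + 2m(1 - s²)/r³]` as a function of the area radius. -/
noncomputable def reggeWheelerV (m ℓ s r : ℝ) : ℝ :=
  (1 - 2 * m / r) * (ℓ * (ℓ + 1) / r ^ 2 + 2 * m * (1 - s ^ 2) / r ^ 3)

/-- The peak (maximum over the exterior `r > 2m`) of the Regge–Wheeler potential. -/
noncomputable def reggeWheelerPeak (m ℓ s : ℝ) : ℝ :=
  sSup (reggeWheelerV m ℓ s '' Set.Ioi (2 * m))

/-- `ψ` is a (twice differentiable) solution on the whole line of the one-dimensional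
Schrödinger equation `ψ'' + (k² - U(x)) ψ = 0`. -/
structure IsSchrodingerSolution (U : ℝ → ℝ) (k : ℝ) (ψ : ℝ → ℂ) : Prop where
  differentiable : Differentiable ℝ ψ
  equation : ∀ x : ℝ, HasDerivAt (deriv ψ) (((U x - k ^ 2 : ℝ) : ℂ) * ψ x) x

/-- The flux-normalised plane wave `exp(i k x) / √|k|`; right-moving if `k > 0`, left-moving if
`k < 0`. -/
noncomputable def planeWave (k x : ℝ) : ℂ :=
  Complex.exp (Complex.I * k * x) / (Real.sqrt |k| : ℝ)

/-- `J` is the Jost solution that is purely right-moving at `+∞`, for a potential `U` vanishing at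
both ends of the line, and `α`, `β` are its Bogoliubov coefficients:
`J(x) → e^{ikx}/√k` as `x → +∞` and `J(x) → α e^{ikx}/√k + β e^{-ikx}/√k` as `x → -∞`. -/
structure IsJostSolution (U : ℝ → ℝ) (k : ℝ) (α β : ℂ) (J : ℝ → ℂ) : Prop where
  solution : IsSchrodingerSolution U k J
  atTop : Tendsto (fun x => J x - planeWave k x) atTop (𝓝 0)
  atBot : Tendsto (fun x => J x - (α * planeWave k x + β * planeWave (-k) x)) atBot (𝓝 0)

/-- `T` is the transmission probability `|t|²`, `t = 1/α`, of the potential `U` at wave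
number `k`. -/
def IsTransmissionProbability (U : ℝ → ℝ) (k T : ℝ) : Prop :=
  ∃ (α β : ℂ) (J : ℝ → ℂ), IsJostSolution U k α β J ∧ α ≠ 0 ∧ T = ‖1 / α‖ ^ 2

/-- `T` is the greybody factor at frequency `ω`: the transmission probability through the
Regge–Wheeler potential, regarded as a function of the tortoise coordinate. -/
def IsGreybodyFactor (m ℓ s ω T : ℝ) : Prop :=
  IsTransmissionProbability (fun x => reggeWheelerV m ℓ s (areaRadius m x)) ω T

/-! For a positive function `h` put S = (|ψ'|²/h + h|ψ|²)/2. Then S² = D² + R² + F², where D =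
(|ψ'|²/h − h|ψ|²)/2, R = Re(ψ̄ψ') and F = Im(ψ̄ψ') is the conserved flux (`sq_waveEnergy`,
`waveFlux_eq`). A Jost solution has F = 1, so S ≥ 1 and both |D| and |R| are at most √(S² − 1). If h
→ k at both ends, S tends to 1 at +∞ and to |α|² + |β|² at −∞. Since |α|² − |β|² = 1, that last
limit is cosh 2θ with |α| = cosh θ and T = sech²θ. Any bound |S'| ≤ g'√(S² − 1) therefore bounds 2θ
by the total increment of g (`arcosh_le_arcosh_add`).

Two choices of h give the two bounds. For h = k, S' = (U/k)R, so 2θ ≤ ∫U/k. For h = √(k² − U), S' =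
−(h'/h)D, so 2θ is at most the total variation of log h, which is 2 log(k/h(p)) when U has a single
peak at p.

The Regge–Wheeler potential fits both: dr/dr_* cancels the factor 1 − 2m/r and makes the integral
elementary, and the sign of V' is that of a quadratic with one root in the exterior. Existence and
uniqueness of T come from variation of constants: the plane-wave amplitudes of a solution have
integrable derivative, hence limits at both ends. -/

/-! ### Analytic tools: linear ODEs, hyperbolic-angle comparison, convergence -/

/-- Global existence for a linear differential equation with bounded continuous coefficients. -/
theorem exists_forall_hasDerivAt_clm {E : Type*} [NormedAddCommGroup E] [NormedSpace ℝ E]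
    [CompleteSpace E] {A : ℝ → E →L[ℝ] E} (hA : Continuous A) {M : ℝ} (hM : ∀ t, ‖A t‖ ≤ M)
    (x₀ : E) : ∃ X : ℝ → E, X 0 = x₀ ∧ ∀ t, HasDerivAt X (A t (X t)) t := by
  have hM0 : 0 ≤ M := (norm_nonneg _).trans (hM 0)
  -- Picard iteration on the whole line for Y = X / cosh(Lt), a smooth two-sided form of the weight
  -- exp(−L|t|). In the sup norm the contraction factor is M/L ≤ 1/2.
  set L : ℝ := 2 * M + 1 with hL
  have hL0 : 0 < L := by positivity
  have hcosh : Continuous fun t : ℝ => Real.cosh (L * t) := by fun_prop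
  have hpos : ∀ t : ℝ, 0 < Real.cosh (L * t) := fun t => Real.cosh_pos _
  have hint : ∀ Y : ℝ → E, Continuous Y →
      Continuous fun s => A s (Real.cosh (L * s) • Y s) := fun Y hY =>
    hA.clm_apply (hcosh.smul hY)
  have key : ∀ Y : ℝ → E, Continuous Y → ∀ C : ℝ, 0 ≤ C → (∀ s, ‖Y s‖ ≤ C) → ∀ t : ℝ,
      ‖(Real.cosh (L * t))⁻¹ • ∫ s in (0 : ℝ)..t, A s (Real.cosh (L * s) • Y s)‖ ≤ C / 2 := by
    intro Y hY C hC hYC t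
    have h1 : ‖∫ s in (0 : ℝ)..t, A s (Real.cosh (L * s) • Y s)‖
        ≤ |∫ s in (0 : ℝ)..t, M * C * Real.cosh (L * s)| := by
      refine intervalIntegral.norm_integral_le_abs_of_norm_le (Eventually.of_forall fun s => ?_)
        (Continuous.intervalIntegrable (by fun_prop) _ _)
      calc ‖A s (Real.cosh (L * s) • Y s)‖ ≤ ‖A s‖ * ‖Real.cosh (L * s) • Y s‖ :=
            (A s).le_opNorm _
        _ ≤ M * (Real.cosh (L * s) * C) := by
            rw [norm_smul, Real.norm_of_nonneg (hpos s).le]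
            gcongr
            exacts [hM s, hYC s]
        _ = M * C * Real.cosh (L * s) := by ring
    have h2 : ∫ s in (0 : ℝ)..t, M * C * Real.cosh (L * s) = M * C * (Real.sinh (L * t) / L) := by
      have hd : ∀ s : ℝ, HasDerivAt (fun s => M * C * (Real.sinh (L * s) / L))
          (M * C * Real.cosh (L * s)) s := by
        intro s
        have h := (((hasDerivAt_id s).const_mul L).sinh.div_const L).const_mul (M * C)
        refine h.congr_deriv ?_
        simp only [id, mul_one]
        field_simp
      rw [intervalIntegral.integral_eq_sub_of_hasDerivAt (fun s _ => hd s)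
        (Continuous.intervalIntegrable (by fun_prop) _ _)]
      simp
    have h3 : |Real.sinh (L * t)| ≤ Real.cosh (L * t) := by
      rw [← Real.cosh_abs (L * t), Real.abs_sinh]
      exact (Real.sinh_lt_cosh _).le
    rw [norm_smul, norm_inv, Real.norm_of_nonneg (hpos t).le, inv_mul_le_iff₀ (hpos t)]
    refine h1.trans ?_
    rw [h2, abs_mul, abs_div, abs_of_pos hL0, abs_of_nonneg (by positivity : 0 ≤ M * C)]
    have h4 : M / L ≤ 1 / 2 := by
      rw [div_le_div_iff₀ hL0 (by norm_num)]
      linarith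
    calc M * C * (|Real.sinh (L * t)| / L) = C * (M / L) * |Real.sinh (L * t)| := by ring
      _ ≤ C * (1 / 2) * Real.cosh (L * t) := by gcongr
      _ = Real.cosh (L * t) * (C / 2) := by ring
  have hcont : ∀ Y : ℝ → E, Continuous Y → Continuous fun t =>
      (Real.cosh (L * t))⁻¹ • (x₀ + ∫ s in (0 : ℝ)..t, A s (Real.cosh (L * s) • Y s)) :=
    fun Y hY => (hcosh.inv₀ fun t => (hpos t).ne').smul (continuous_const.add
      (intervalIntegral.continuous_primitive
        (fun a b => (hint Y hY).intervalIntegrable a b) 0))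
  let T : BoundedContinuousFunction ℝ E → BoundedContinuousFunction ℝ E := fun Y =>
    BoundedContinuousFunction.ofNormedAddCommGroup _ (hcont Y Y.continuous)
      (‖x₀‖ + ‖Y‖ / 2) (by
        intro t
        rw [smul_add]
        refine (norm_add_le _ _).trans (add_le_add ?_
          (key Y Y.continuous _ (norm_nonneg _) Y.norm_coe_le_norm t))
        rw [norm_smul, norm_inv, Real.norm_of_nonneg (hpos t).le]
        exact mul_le_of_le_one_left (norm_nonneg _) (inv_le_one_of_one_le₀ (Real.one_le_cosh _)))
  have hT : ContractingWith (1 / 2) T := by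
    refine ⟨by rw [div_lt_one (by norm_num)]; norm_num, LipschitzWith.of_dist_le_mul fun Y Z => ?_⟩
    rw [BoundedContinuousFunction.dist_le (by positivity)]
    intro t
    have h := key (fun s => Y s - Z s) (Y.continuous.sub Z.continuous) (dist Y Z) dist_nonneg
      (fun s => by rw [← dist_eq_norm]; exact BoundedContinuousFunction.dist_coe_le_dist s) t
    rw [dist_eq_norm]
    have e : T Y t - T Z t = (Real.cosh (L * t))⁻¹ •
        ∫ s in (0 : ℝ)..t, A s (Real.cosh (L * s) • (Y s - Z s)) := by
      change (Real.cosh (L * t))⁻¹ • (x₀ + ∫ s in (0 : ℝ)..t, A s (Real.cosh (L * s) • Y s)) -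
        (Real.cosh (L * t))⁻¹ • (x₀ + ∫ s in (0 : ℝ)..t, A s (Real.cosh (L * s) • Z s)) = _
      rw [← smul_sub, add_sub_add_left_eq_sub, ← intervalIntegral.integral_sub
        ((hint Y Y.continuous).intervalIntegrable _ _)
        ((hint Z Z.continuous).intervalIntegrable _ _)]
      simp only [smul_sub, map_sub]
    rw [e]
    refine h.trans (le_of_eq ?_)
    push_cast
    ring
  obtain ⟨Y, hY⟩ : ∃ Y, T Y = Y := ⟨_, hT.fixedPoint_isFixedPt⟩
  have hX : ∀ t, Real.cosh (L * t) • Y t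
      = x₀ + ∫ s in (0 : ℝ)..t, A s (Real.cosh (L * s) • Y s) := by
    intro t
    have h : (Real.cosh (L * t))⁻¹ • (x₀ + ∫ s in (0 : ℝ)..t, A s (Real.cosh (L * s) • Y s))
      = Y t := congrArg (fun Z : BoundedContinuousFunction ℝ E => Z t) hY
    rw [← h, smul_inv_smul₀ (hpos t).ne']
  refine ⟨fun t => Real.cosh (L * t) • Y t, ?_, fun t => ?_⟩
  · simpa using hX 0
  · have hc := hint Y Y.continuous
    have h := (intervalIntegral.integral_hasDerivAt_right (hc.intervalIntegrable 0 t)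
      (hc.stronglyMeasurableAtFilter _ _) hc.continuousAt).const_add x₀
    exact h.congr_of_eventuallyEq (Eventually.of_forall hX)

/-- A function `S ≥ 1` whose rate of change is controlled by `g' √(S² - 1)` changes its
hyperbolic angle by at most the increment of `g`. -/
theorem arcosh_le_arcosh_add {S S' g g' : ℝ → ℝ} {x y : ℝ} (hxy : x ≤ y)
    (hS : ∀ t ∈ Set.Icc x y, HasDerivAt S (S' t) t)
    (hg : ∀ t ∈ Set.Icc x y, HasDerivAt g (g' t) t) (h1 : ∀ t ∈ Set.Icc x y, 1 ≤ S t)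
    (hg0 : ∀ t ∈ Set.Icc x y, 0 ≤ g' t)
    (hb : ∀ t ∈ Set.Icc x y, |S' t| ≤ g' t * √(S t ^ 2 - 1)) :
    Real.arcosh (S x) ≤ Real.arcosh (S y) + (g y - g x) := by
  -- `Real.arcosh` is not differentiable at 1, a value that S may take. The estimate is proved for
  -- cS with c > 1, where c√(S² − 1) ≤ √((cS)² − 1) preserves the bound, and then c → 1.
  have hlim : ∀ t ∈ Set.Icc x y,
      Tendsto (fun c => Real.arcosh (c * S t)) (𝓝[>] 1) (𝓝 (Real.arcosh (S t))) := by
    intro t ht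
    refine (Real.continuousOn_arcosh (S t) (h1 t ht)).tendsto.comp
      (tendsto_nhdsWithin_iff.2 ⟨?_, ?_⟩)
    · have : Tendsto (fun c : ℝ => c * S t) (𝓝 1) (𝓝 (1 * S t)) :=
        tendsto_id.mul_const _
      rw [one_mul] at this
      exact this.mono_left nhdsWithin_le_nhds
    · filter_upwards [self_mem_nhdsWithin] with c hc
      have hc' : 1 < c := hc
      have := h1 t ht
      simp only [Set.mem_Ici]
      nlinarith
  have hx : x ∈ Set.Icc x y := ⟨le_rfl, hxy⟩
  have hy : y ∈ Set.Icc x y := ⟨hxy, le_rfl⟩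
  refine le_of_tendsto_of_tendsto (hlim x hx) ((hlim y hy).add_const _) ?_
  filter_upwards [self_mem_nhdsWithin] with c hc
  have hc1 : 1 < c := hc
  have hgt : ∀ t ∈ Set.Icc x y, 1 < c * S t := fun t ht => by nlinarith [h1 t ht]
  have hF : ∀ t ∈ Set.Icc x y, HasDerivAt (fun t => Real.arcosh (c * S t) + g t)
      ((√((c * S t) ^ 2 - 1))⁻¹ * (c * S' t) + g' t) t := fun t ht =>
    (HasDerivAt.comp (h₂ := Real.arcosh) t (Real.hasDerivAt_arcosh (hgt t ht))
      ((hS t ht).const_mul c)).add (hg t ht)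
  have hmono : MonotoneOn (fun t => Real.arcosh (c * S t) + g t) (Set.Icc x y) := by
    refine monotoneOn_of_hasDerivWithinAt_nonneg (convex_Icc x y)
      (fun t ht => (hF t ht).continuousAt.continuousWithinAt)
      (fun t ht => (hF t (interior_subset ht)).hasDerivWithinAt) (fun t ht => ?_)
    have ht := interior_subset ht
    have hpos : 0 < √((c * S t) ^ 2 - 1) := Real.sqrt_pos.2 (by nlinarith [hgt t ht])
    have hsq : c * √(S t ^ 2 - 1) ≤ √((c * S t) ^ 2 - 1) := by
      refine Real.le_sqrt_of_sq_le ?_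
      rw [mul_pow, Real.sq_sqrt (by nlinarith [h1 t ht])]
      nlinarith
    have hg0 := hg0 t ht
    have : -(c * S' t) ≤ √((c * S t) ^ 2 - 1) * g' t := by
      calc -(c * S' t) ≤ c * |S' t| := by nlinarith [neg_abs_le (S' t)]
        _ ≤ c * (g' t * √(S t ^ 2 - 1)) := by gcongr; exact hb t ht
        _ = (c * √(S t ^ 2 - 1)) * g' t := by ring
        _ ≤ _ := by gcongr
    have h2 : -(g' t) ≤ (√((c * S t) ^ 2 - 1))⁻¹ * (c * S' t) := by
      rw [le_inv_mul_iff₀ hpos]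
      linarith
    linarith
  have := hmono hx hy hxy
  simp only at this
  linarith

/-- If `‖f'‖ ≤ C Φ'` and `Φ` converges along a filter, so does `f`. -/
theorem exists_tendsto_of_norm_deriv_le {f f' : ℝ → ℂ} {Φ Φ' : ℝ → ℝ} {C c : ℝ} {l : Filter ℝ}
    [l.NeBot] (hf : ∀ x, HasDerivAt f (f' x) x) (hΦ : ∀ x, HasDerivAt Φ (Φ' x) x)
    (hle : ∀ x, ‖f' x‖ ≤ C * Φ' x) (hl : Tendsto Φ l (𝓝 c)) : ∃ z, Tendsto f l (𝓝 z) := by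
  have hord : ∀ x y, x ≤ y → ‖f y - f x‖ ≤ C * (Φ y - Φ x) := by
    intro x y hxy
    have hB : ∀ t, HasDerivAt (fun t => C * (Φ t - Φ x)) (C * Φ' t) t := fun t =>
      ((hΦ t).sub_const _).const_mul C
    exact image_norm_le_of_norm_deriv_right_le_deriv_boundary (f := fun t => f t - f x)
      (f' := f') (a := x) (b := y)
      (fun t _ => ((hf t).sub_const _).continuousAt.continuousWithinAt)
      (fun t _ => ((hf t).sub_const _).hasDerivWithinAt) (by simp) hB
      (fun t _ => hle t) ⟨hxy, le_rfl⟩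
  -- This symmetric form transfers the Cauchy property from Φ to f along any filter.
  have hdist : ∀ x y, dist (f x) (f y) ≤ |C| * dist (Φ x) (Φ y) := by
    intro x y
    rw [Real.dist_eq, ← abs_mul]
    rcases le_total x y with h | h
    · rw [dist_comm, dist_eq_norm, abs_mul, abs_sub_comm, ← abs_mul]
      exact (hord x y h).trans (le_abs_self _)
    · rw [dist_eq_norm]
      exact (hord y x h).trans (le_abs_self _)
  rw [← cauchy_map_iff_exists_tendsto, cauchy_map_iff]
  refine ⟨inferInstance, ?_⟩
  rw [tendsto_uniformity_iff_dist_tendsto_zero]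
  have hΦc := (cauchy_map_iff.1 (cauchy_map_iff_exists_tendsto.2 ⟨c, hl⟩)).2
  rw [tendsto_uniformity_iff_dist_tendsto_zero] at hΦc
  have h0 := hΦc.const_mul |C|
  rw [mul_zero] at h0
  exact squeeze_zero (fun _ => dist_nonneg) (fun p => hdist p.1 p.2) h0

/-! ### Energy, flux and plane-wave amplitudes -/

open scoped ComplexConjugate

/-- The energy of `ψ` at `x` relative to the local wave number `h`. -/
noncomputable def waveEnergy (h : ℝ) (ψ : ℝ → ℂ) (x : ℝ) : ℝ :=
  (‖deriv ψ x‖ ^ 2 / h + h * ‖ψ x‖ ^ 2) / 2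

/-- The probability flux of a wave function. -/
noncomputable def waveFlux (ψ : ℝ → ℂ) (x : ℝ) : ℝ :=
  (conj (ψ x) * deriv ψ x).im

/-- The coefficient of `planeWave k` in the local decomposition of `ψ` into plane waves. -/
noncomputable def waveAmplitude (k : ℝ) (ψ : ℝ → ℂ) (x : ℝ) : ℂ :=
  ((√|k| / 2 : ℝ) : ℂ) * Complex.exp (-(Complex.I * k * x)) * (ψ x + deriv ψ x / (Complex.I * k))

theorem norm_planeWave (k x : ℝ) : ‖planeWave k x‖ = 1 / √|k| := by
  rw [planeWave, norm_div, Complex.norm_real, Real.norm_of_nonneg (Real.sqrt_nonneg _)]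
  congr 1
  rw [show Complex.I * k * x = ((k * x : ℝ) : ℂ) * Complex.I by push_cast; ring,
    Complex.norm_exp_ofReal_mul_I]

theorem conj_planeWave (k x : ℝ) : conj (planeWave k x) = planeWave (-k) x := by
  rw [planeWave, planeWave, map_div₀, Complex.conj_ofReal, abs_neg, ← Complex.exp_conj]
  simp

/-- The decomposition is exact at every point, so limits of the two amplitudes are precisely the
scattering asymptotics. -/
theorem waveAmplitude_mul_planeWave_add {k : ℝ} (hk : k ≠ 0) (ψ : ℝ → ℂ) (x : ℝ) :
    waveAmplitude k ψ x * planeWave k x + waveAmplitude (-k) ψ x * planeWave (-k) x = ψ x := by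
  have hs : ((√|k| : ℝ) : ℂ) ≠ 0 := by
    exact_mod_cast (Real.sqrt_pos.2 (abs_pos.2 hk)).ne'
  have hk' : (k : ℂ) ≠ 0 := by exact_mod_cast hk
  have he : Complex.exp (Complex.I * k * x) ≠ 0 := Complex.exp_ne_zero _
  simp only [waveAmplitude, planeWave, abs_neg, Complex.ofReal_neg, mul_neg, neg_mul, neg_neg,
    Complex.exp_neg, Complex.ofReal_div, Complex.ofReal_ofNat]
  field_simp
  ring

theorem waveAmplitude_conj (k : ℝ) {ψ : ℝ → ℂ} (hψ : Differentiable ℝ ψ) (x : ℝ) :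
    waveAmplitude k (fun t => conj (ψ t)) x = conj (waveAmplitude (-k) ψ x) := by
  have hd : deriv (fun t => conj (ψ t)) x = conj (deriv ψ x) :=
    ((Complex.conjCLE.toContinuousLinearMap.hasFDerivAt.comp_hasDerivAt x
      (hψ x).hasDerivAt)).deriv
  simp only [waveAmplitude, hd, map_mul, map_add, map_div₀, Complex.conj_ofReal, Complex.conj_I,
    ← Complex.exp_conj, map_neg, Complex.ofReal_neg, abs_neg]
  ring_nf

theorem waveAmplitude_linear (k : ℝ) {ψ φ : ℝ → ℂ} (hψ : Differentiable ℝ ψ)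
    (hφ : Differentiable ℝ φ) (a b : ℂ) (x : ℝ) :
    waveAmplitude k (fun t => a * ψ t + b * φ t) x
      = a * waveAmplitude k ψ x + b * waveAmplitude k φ x := by
  have hd : deriv (fun t => a * ψ t + b * φ t) x = a * deriv ψ x + b * deriv φ x :=
    (((hψ x).hasDerivAt.const_mul a).add ((hφ x).hasDerivAt.const_mul b)).deriv
  simp only [waveAmplitude, hd]
  ring

theorem sq_norm_waveAmplitude {k : ℝ} (hk : k ≠ 0) (ψ : ℝ → ℂ) (x : ℝ) :
    ‖waveAmplitude k ψ x‖ ^ 2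
      = |k| / 4 * (((ψ x).re + (deriv ψ x).im / k) ^ 2 + ((ψ x).im - (deriv ψ x).re / k) ^ 2) := by
  have he : ‖Complex.exp (-(Complex.I * k * x))‖ = 1 := by
    rw [show -(Complex.I * k * x) = ((-(k * x) : ℝ) : ℂ) * Complex.I by push_cast; ring,
      Complex.norm_exp_ofReal_mul_I]
  have hk' : (k : ℂ) ≠ 0 := by exact_mod_cast hk
  have hw : deriv ψ x / (Complex.I * k)
      = (((deriv ψ x).im / k : ℝ) : ℂ) + ((-((deriv ψ x).re / k) : ℝ) : ℂ) * Complex.I := by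
    conv_lhs => rw [← Complex.re_add_im (deriv ψ x)]
    push_cast
    field_simp
    ring_nf
    simp only [Complex.I_sq]
    ring
  rw [waveAmplitude, norm_mul, norm_mul, he, Complex.norm_real,
    Real.norm_of_nonneg (by positivity), mul_one, mul_pow, div_pow, Real.sq_sqrt (abs_nonneg k),
    hw, Complex.sq_norm, Complex.normSq_apply]
  simp
  ring

/-- With the companion difference formula, this turns limits of energy and flux into |α|² ± |β|². -/
theorem sq_norm_waveAmplitude_add {k : ℝ} (hk : 0 < k) (ψ : ℝ → ℂ) (x : ℝ) :
    ‖waveAmplitude k ψ x‖ ^ 2 + ‖waveAmplitude (-k) ψ x‖ ^ 2 = waveEnergy k ψ x := by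
  rw [sq_norm_waveAmplitude hk.ne', sq_norm_waveAmplitude (neg_ne_zero.2 hk.ne'), abs_neg,
    abs_of_pos hk, waveEnergy, Complex.sq_norm, Complex.sq_norm, Complex.normSq_apply,
    Complex.normSq_apply]
  field_simp
  ring

theorem sq_norm_waveAmplitude_sub {k : ℝ} (hk : 0 < k) (ψ : ℝ → ℂ) (x : ℝ) :
    ‖waveAmplitude k ψ x‖ ^ 2 - ‖waveAmplitude (-k) ψ x‖ ^ 2 = waveFlux ψ x := by
  rw [sq_norm_waveAmplitude hk.ne', sq_norm_waveAmplitude (neg_ne_zero.2 hk.ne'), abs_neg,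
    abs_of_pos hk, waveFlux]
  simp only [Complex.mul_im, Complex.conj_re, Complex.conj_im]
  field_simp
  ring

theorem waveEnergy_nonneg {h : ℝ} (hh : 0 < h) (ψ : ℝ → ℂ) (x : ℝ) : 0 ≤ waveEnergy h ψ x := by
  unfold waveEnergy
  positivity

/-- The square of the energy splits into the flux and two real quadratic forms. -/
theorem sq_waveEnergy {h : ℝ} (hh : 0 < h) (ψ : ℝ → ℂ) (x : ℝ) :
    waveEnergy h ψ x ^ 2 = ((‖deriv ψ x‖ ^ 2 / h - h * ‖ψ x‖ ^ 2) / 2) ^ 2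
      + (inner ℝ (ψ x) (deriv ψ x)) ^ 2 + waveFlux ψ x ^ 2 := by
  rw [waveEnergy, waveFlux, Complex.inner, Complex.sq_norm, Complex.sq_norm, Complex.normSq_apply,
    Complex.normSq_apply]
  simp only [Complex.mul_im, Complex.mul_re, Complex.conj_re, Complex.conj_im]
  field_simp
  ring

/-- Energies relative to two local wave numbers are comparable. -/
theorem waveEnergy_le_div_mul {h k : ℝ} (hh : 0 < h) (hk : h ≤ k) (ψ : ℝ → ℂ) (x : ℝ) :
    waveEnergy h ψ x ≤ k / h * waveEnergy k ψ x ∧ waveEnergy k ψ x ≤ k / h * waveEnergy h ψ x := by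
  have hk0 : 0 < k := hh.trans_le hk
  have h1 : h * ‖ψ x‖ ^ 2 ≤ k ^ 2 / h * ‖ψ x‖ ^ 2 := by
    gcongr
    rw [le_div_iff₀ hh]
    nlinarith
  have h2 : ‖deriv ψ x‖ ^ 2 / k ≤ ‖deriv ψ x‖ ^ 2 * (k / h ^ 2) := by
    rw [div_eq_mul_one_div]
    gcongr ?_ * ?_
    rw [div_le_div_iff₀ hk0 (by positivity)]
    nlinarith
  unfold waveEnergy
  constructor
  · calc (‖deriv ψ x‖ ^ 2 / h + h * ‖ψ x‖ ^ 2) / 2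
        ≤ (‖deriv ψ x‖ ^ 2 / h + k ^ 2 / h * ‖ψ x‖ ^ 2) / 2 := by linarith
      _ = _ := by field_simp
  · calc (‖deriv ψ x‖ ^ 2 / k + k * ‖ψ x‖ ^ 2) / 2
        ≤ (‖deriv ψ x‖ ^ 2 * (k / h ^ 2) + k * ‖ψ x‖ ^ 2) / 2 := by linarith
      _ = _ := by field_simp

/-! ### Evolution of amplitudes, flux and energy along a solution -/

namespace IsSchrodingerSolution

variable {U : ℝ → ℝ} {k : ℝ} {ψ φ : ℝ → ℂ}

theorem of_hasDerivAt {χ : ℝ → ℂ} (h1 : ∀ x, HasDerivAt ψ (χ x) x)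
    (h2 : ∀ x, HasDerivAt χ (((U x - k ^ 2 : ℝ) : ℂ) * ψ x) x) : IsSchrodingerSolution U k ψ := by
  have hd : deriv ψ = χ := funext fun x => (h1 x).deriv
  exact ⟨fun x => (h1 x).differentiableAt, fun x => by rw [hd]; exact h2 x⟩

theorem hasDerivAt (hψ : IsSchrodingerSolution U k ψ) (x : ℝ) : HasDerivAt ψ (deriv ψ x) x :=
  (hψ.differentiable x).hasDerivAt

theorem linear (hψ : IsSchrodingerSolution U k ψ) (hφ : IsSchrodingerSolution U k φ) (a b : ℂ) :
    IsSchrodingerSolution U k fun t => a * ψ t + b * φ t :=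
  of_hasDerivAt (χ := fun t => a * deriv ψ t + b * deriv φ t)
    (fun x => ((hψ.hasDerivAt x).const_mul a).add ((hφ.hasDerivAt x).const_mul b))
    (fun x => (((hψ.equation x).const_mul a).add ((hφ.equation x).const_mul b)).congr_deriv
      (by ring))

theorem conjugate (hψ : IsSchrodingerSolution U k ψ) :
    IsSchrodingerSolution U k fun t => (starRingEnd ℂ) (ψ t) :=
  of_hasDerivAt (χ := fun t => (starRingEnd ℂ) (deriv ψ t))
    (fun x => Complex.conjCLE.toContinuousLinearMap.hasFDerivAt.comp_hasDerivAt x (hψ.hasDerivAt x))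
    (fun x => (Complex.conjCLE.toContinuousLinearMap.hasFDerivAt.comp_hasDerivAt x
      (hψ.equation x)).congr_deriv (by simp))

/-- Variation of constants: as κ² = k², the free terms cancel and only the potential drives the
amplitude. -/
theorem hasDerivAt_waveAmplitude (hψ : IsSchrodingerSolution U k ψ) {κ : ℝ} (hκ : κ ≠ 0)
    (hsq : κ ^ 2 = k ^ 2) (x : ℝ) :
    HasDerivAt (waveAmplitude κ ψ) (((√|κ| / 2 : ℝ) : ℂ) * Complex.exp (-(Complex.I * κ * x)) *
      (U x * ψ x / (Complex.I * κ))) x := by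
  have he : HasDerivAt (fun t : ℝ => Complex.exp (-(Complex.I * κ * t)))
      (Complex.exp (-(Complex.I * κ * x)) * -(Complex.I * κ * 1)) x :=
    (((hasDerivAt_id x).ofReal_comp.const_mul (Complex.I * κ)).neg).cexp
  have h := (he.const_mul ((√|κ| / 2 : ℝ) : ℂ)).mul
    ((hψ.hasDerivAt x).add ((hψ.equation x).div_const (Complex.I * κ)))
  refine h.congr_deriv ?_
  have hκ' : (κ : ℂ) ≠ 0 := by exact_mod_cast hκ
  have hsq' : (κ : ℂ) ^ 2 = (k : ℂ) ^ 2 := by exact_mod_cast hsq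
  rw [Complex.ofReal_sub, Complex.ofReal_pow, ← hsq']
  simp only [Pi.add_apply]
  field_simp
  ring_nf
  simp only [Complex.I_sq]
  ring

theorem norm_deriv_waveAmplitude_le {C κ : ℝ} (hκ : κ ≠ 0) {x : ℝ} (hU : 0 ≤ U x)
    (hC : ‖ψ x‖ ≤ C) :
    ‖((√|κ| / 2 : ℝ) : ℂ) * Complex.exp (-(Complex.I * κ * x)) *
      (U x * ψ x / (Complex.I * κ))‖ ≤ √|κ| / 2 * C / |κ| * U x := by
  have he : ‖Complex.exp (-(Complex.I * κ * x))‖ = 1 := by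
    rw [show -(Complex.I * κ * x) = ((-(κ * x) : ℝ) : ℂ) * Complex.I by push_cast; ring,
      Complex.norm_exp_ofReal_mul_I]
  rw [norm_mul, norm_mul, he, norm_div, norm_mul, norm_mul, Complex.norm_I, Complex.norm_real,
    Complex.norm_real, Complex.norm_real, Real.norm_of_nonneg (by positivity), Real.norm_eq_abs κ,
    Real.norm_of_nonneg hU, mul_one, one_mul]
  have : 0 < |κ| := abs_pos.2 hκ
  calc √|κ| / 2 * (U x * ‖ψ x‖ / |κ|) ≤ √|κ| / 2 * (U x * C / |κ|) := by gcongr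
    _ = _ := by ring

/-- The derivative is Im(|ψ'|² + (U − k²)|ψ|²), which vanishes because the potential is real. -/
theorem waveFlux_eq (hψ : IsSchrodingerSolution U k ψ) (x y : ℝ) :
    waveFlux ψ x = waveFlux ψ y := by
  have hd : ∀ x, HasDerivAt (waveFlux ψ) 0 x := by
    intro x
    have h1 : HasDerivAt (fun t => (starRingEnd ℂ) (ψ t)) ((starRingEnd ℂ) (deriv ψ x)) x :=
      Complex.conjCLE.toContinuousLinearMap.hasFDerivAt.comp_hasDerivAt x (hψ.hasDerivAt x)
    have h := Complex.imCLM.hasFDerivAt.comp_hasDerivAt x (h1.mul (hψ.equation x))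
    refine h.congr_deriv ?_
    generalize U x - k ^ 2 = q
    simp
    ring
  exact is_const_of_deriv_eq_zero (fun x => (hd x).differentiableAt) (fun x => (hd x).deriv) x y

/-- A constant h removes the second term; h = √(k² − U) removes the first. -/
theorem hasDerivAt_waveEnergy (hψ : IsSchrodingerSolution U k ψ) {h : ℝ → ℝ} {h' x : ℝ}
    (hh : HasDerivAt h h' x) (hpos : 0 < h x) :
    HasDerivAt (fun t => waveEnergy (h t) ψ t)
      ((h x + (U x - k ^ 2) / h x) * inner ℝ (ψ x) (deriv ψ x)
        - h' / h x * ((‖deriv ψ x‖ ^ 2 / h x - h x * ‖ψ x‖ ^ 2) / 2)) x := by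
  have h1 := (hψ.hasDerivAt x).norm_sq
  have h2 := (hψ.equation x).norm_sq
  have h3 := ((h2.div hh hpos.ne').add (hh.mul h1)).div_const 2
  refine h3.congr_deriv ?_
  have e : inner ℝ (deriv ψ x) (((U x - k ^ 2 : ℝ) : ℂ) * ψ x)
      = (U x - k ^ 2) * inner ℝ (ψ x) (deriv ψ x) := by
    rw [← Complex.real_smul, inner_smul_right, real_inner_comm]
  rw [e]
  field_simp
  ring

theorem abs_deriv_waveEnergy_le (hψ : IsSchrodingerSolution U k ψ) (hk : 0 < k) {x : ℝ}
    (hU : 0 ≤ U x) : HasDerivAt (waveEnergy k ψ) (U x / k * inner ℝ (ψ x) (deriv ψ x)) x ∧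
    |U x / k * inner ℝ (ψ x) (deriv ψ x)| ≤ U x / k * √(waveEnergy k ψ x ^ 2 - waveFlux ψ x ^ 2) := by
  constructor
  · refine (hψ.hasDerivAt_waveEnergy (hasDerivAt_const x k) hk).congr_deriv ?_
    field_simp
    ring
  · rw [abs_mul, abs_of_nonneg (by positivity)]
    gcongr
    refine Real.abs_le_sqrt ?_
    rw [sq_waveEnergy hk]
    nlinarith [sq_nonneg ((‖deriv ψ x‖ ^ 2 / k - k * ‖ψ x‖ ^ 2) / 2)]

/-- Grönwall bound for the energy, in either direction of the line. -/
theorem waveEnergy_le_exp_mul (hψ : IsSchrodingerSolution U k ψ) (hk : 0 < k) {Φ : ℝ → ℝ}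
    (hU : ∀ x, 0 ≤ U x) (hΦ : ∀ x, HasDerivAt Φ (U x) x) (x y : ℝ) :
    waveEnergy k ψ x ≤ Real.exp (|Φ x - Φ y| / k) * waveEnergy k ψ y := by
  have hle : ∀ x, |U x / k * inner ℝ (ψ x) (deriv ψ x)| ≤ U x / k * waveEnergy k ψ x := fun x => by
    refine (hψ.abs_deriv_waveEnergy_le hk (hU x)).2.trans ?_
    have := hU x
    gcongr
    refine Real.sqrt_le_iff.2 ⟨waveEnergy_nonneg hk ψ x, ?_⟩
    nlinarith [sq_nonneg (waveFlux ψ x)]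
  have hd : ∀ c x, HasDerivAt (fun t => Real.exp (c * (Φ t / k)) * waveEnergy k ψ t)
      (Real.exp (c * (Φ x / k)) * (c * (U x / k)) * waveEnergy k ψ x
        + Real.exp (c * (Φ x / k)) * (U x / k * inner ℝ (ψ x) (deriv ψ x))) x := fun c x =>
    ((((hΦ x).div_const k).const_mul c).exp).mul (hψ.abs_deriv_waveEnergy_le hk (hU x)).1
  have hexp : ∀ a b : ℝ, Real.exp (a / k) * waveEnergy k ψ x ≤ Real.exp (b / k) * waveEnergy k ψ y →
      waveEnergy k ψ x ≤ Real.exp ((b - a) / k) * waveEnergy k ψ y := by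
    intro a b hab
    rw [sub_div, Real.exp_sub, div_mul_eq_mul_div, le_div_iff₀ (Real.exp_pos _), mul_comm]
    exact hab
  rcases le_total x y with hxy | hxy
  · have hm : Monotone fun t => Real.exp (1 * (Φ t / k)) * waveEnergy k ψ t := by
      refine monotone_of_hasDerivAt_nonneg (hd 1) fun t => ?_
      have := neg_le_of_abs_le (hle t)
      have := Real.exp_pos (1 * (Φ t / k))
      simp only [Pi.zero_apply]
      nlinarith
    have h1 := hm hxy
    simp only [one_mul] at h1
    refine (hexp _ _ h1).trans ?_
    have := waveEnergy_nonneg hk ψ y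
    gcongr
    rw [abs_sub_comm]
    exact le_abs_self _
  · have hm : Antitone fun t => Real.exp (-1 * (Φ t / k)) * waveEnergy k ψ t := by
      refine antitone_of_hasDerivAt_nonpos (hd (-1)) fun t => ?_
      have := le_of_abs_le (hle t)
      have := Real.exp_pos (-1 * (Φ t / k))
      simp only [Pi.zero_apply]
      nlinarith
    have h1 := hm hxy
    simp only [neg_mul, one_mul, ← neg_div] at h1
    refine (hexp _ _ h1).trans ?_
    have := waveEnergy_nonneg hk ψ y
    gcongr
    rw [sub_neg_eq_add, neg_add_eq_sub]
    exact le_abs_self _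

end IsSchrodingerSolution

/-! ### Scattering for short-range potentials -/

/-- A nonnegative bounded continuous potential `U` vanishing at both ends of the line, with an
antiderivative `Φ` converging to `Φbot` at `-∞` and to `Φtop` at `+∞`. -/
structure IsShortRange (U Φ : ℝ → ℝ) (Φbot Φtop : ℝ) : Prop where
  continuous : Continuous U
  nonneg : ∀ x, 0 ≤ U x
  bounded : ∃ M, ∀ x, U x ≤ M
  hasDerivAt : ∀ x, HasDerivAt Φ (U x) x
  tendsto_atTop : Tendsto U atTop (𝓝 0)
  tendsto_atBot : Tendsto U atBot (𝓝 0)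
  primitive_atTop : Tendsto Φ atTop (𝓝 Φtop)
  primitive_atBot : Tendsto Φ atBot (𝓝 Φbot)

/-- Plane waves of opposite wave numbers are asymptotically independent. -/
theorem planeWave_coeff_eq_zero {k : ℝ} (hk : 0 < k) {a b : ℂ} {l : Filter ℝ} [l.NeBot]
    (hl : ∀ τ : ℝ, Tendsto (fun x => x + τ) l l)
    (h : Tendsto (fun x => a * planeWave k x + b * planeWave (-k) x) l (𝓝 0)) :
    a = 0 ∧ b = 0 := by
  -- A quarter-period shift multiplies the two waves by i and −i, so the original and shifted
  -- relations can be solved for each wave separately.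
  set τ : ℝ := Real.pi / (2 * k) with hτ
  have hkτ : (k : ℂ) * τ = Real.pi / 2 := by
    have : k * τ = Real.pi / 2 := by rw [hτ]; field_simp
    exact_mod_cast congrArg (Complex.ofReal) this
  have h1 : ∀ x, planeWave k (x + τ) = Complex.I * planeWave k x := by
    intro x
    have : Complex.I * k * ((x + τ : ℝ) : ℂ)
        = Real.pi / 2 * Complex.I + Complex.I * k * x := by
      push_cast
      linear_combination Complex.I * hkτ
    rw [planeWave, planeWave, this, Complex.exp_add, Complex.exp_pi_div_two_mul_I]
    ring
  have h2 : ∀ x, planeWave (-k) (x + τ) = -Complex.I * planeWave (-k) x := by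
    intro x
    rw [← conj_planeWave, h1, map_mul, conj_planeWave, Complex.conj_I]
  have hs := h.comp (hl τ)
  simp only [Function.comp_def, h1, h2] at hs
  have hA : Tendsto (fun x => a * planeWave k x) l (𝓝 0) := by
    have := (h.add (hs.const_mul (-Complex.I))).const_mul (1 / 2)
    simp only [mul_zero, add_zero] at this
    refine this.congr fun x => ?_
    linear_combination (-(1 / 2) * a * planeWave k x + 1 / 2 * b * planeWave (-k) x) * Complex.I_sq
  have hB : Tendsto (fun x => b * planeWave (-k) x) l (𝓝 0) := by
    have := h.sub hA
    simpa using this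
  have hpos : 0 < √|k| := Real.sqrt_pos.2 (abs_pos.2 hk.ne')
  constructor
  · have := hA.norm
    simp only [norm_mul, norm_planeWave, norm_zero] at this
    have := tendsto_nhds_unique this tendsto_const_nhds
    have h0 : ‖a‖ = 0 := by
      rcases mul_eq_zero.1 this.symm with h | h
      · exact h
      · exact absurd h (by positivity)
    exact norm_eq_zero.1 h0
  · have := hB.norm
    simp only [norm_mul, norm_planeWave, norm_zero, abs_neg] at this
    have := tendsto_nhds_unique this tendsto_const_nhds
    have h0 : ‖b‖ = 0 := by
      rcases mul_eq_zero.1 this.symm with h | h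
      · exact h
      · exact absurd h (by positivity)
    exact norm_eq_zero.1 h0

/-- A family of wave functions decomposed into plane waves with convergent coefficients has
the corresponding superposition as asymptotics. -/
theorem tendsto_sub_planeWave {k : ℝ} {u v : ℝ → ℂ} {a b : ℂ} {l : Filter ℝ}
    (hu : Tendsto u l (𝓝 a)) (hv : Tendsto v l (𝓝 b)) :
    Tendsto (fun x => u x * planeWave k x + v x * planeWave (-k) x
      - (a * planeWave k x + b * planeWave (-k) x)) l (𝓝 0) := by
  have hz : ∀ (w : ℝ → ℂ) (c : ℂ) (κ : ℝ), Tendsto w l (𝓝 c) →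
      Tendsto (fun x => (w x - c) * planeWave κ x) l (𝓝 0) := by
    intro w c κ hw
    have h0 : Tendsto (fun x => w x - c) l (𝓝 0) := by simpa using hw.sub_const c
    refine h0.zero_mul_isBoundedUnder_le ?_
    refine isBoundedUnder_of ⟨1 / √|κ|, fun x => ?_⟩
    simp [norm_planeWave]
  have := (hz u a k hu).add (hz v b (-k) hv)
  rw [add_zero] at this
  refine this.congr fun x => ?_
  ring

namespace IsShortRange

variable {U Φ : ℝ → ℝ} {Φbot Φtop k : ℝ}

/-- The Grönwall factor is uniform because Φ has finite total increment. -/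
theorem exists_norm_le (hU : IsShortRange U Φ Φbot Φtop) (hk : 0 < k) {ψ : ℝ → ℂ}
    (hψ : IsSchrodingerSolution U k ψ) : ∃ C, ∀ x, ‖ψ x‖ ≤ C := by
  have hmono : Monotone Φ := monotone_of_hasDerivAt_nonneg hU.hasDerivAt hU.nonneg
  have hle : ∀ x y, |Φ x - Φ y| ≤ Φtop - Φbot := fun x y => by
    have h1 := hmono.ge_of_tendsto hU.primitive_atTop
    have h2 := hmono.le_of_tendsto hU.primitive_atBot
    rw [abs_sub_le_iff]
    constructor <;> linarith [h1 x, h1 y, h2 x, h2 y]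
  set B := Real.exp ((Φtop - Φbot) / k) * waveEnergy k ψ 0
  have hB : ∀ x, waveEnergy k ψ x ≤ B := fun x => by
    refine (hψ.waveEnergy_le_exp_mul hk hU.nonneg hU.hasDerivAt x 0).trans ?_
    have := waveEnergy_nonneg hk ψ 0
    refine mul_le_mul_of_nonneg_right (Real.exp_le_exp.2 ?_) this
    have := hle x 0
    gcongr
  refine ⟨√(2 * B / k), fun x => Real.le_sqrt_of_sq_le ?_⟩
  rw [le_div_iff₀ hk]
  have h1 := hB x
  rw [waveEnergy] at h1
  have : 0 ≤ ‖deriv ψ x‖ ^ 2 / k := by positivity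
  linarith

theorem exists_tendsto_waveAmplitude (hU : IsShortRange U Φ Φbot Φtop) (hk : 0 < k) {ψ : ℝ → ℂ}
    (hψ : IsSchrodingerSolution U k ψ) {κ : ℝ} (hκ : κ ≠ 0) (hsq : κ ^ 2 = k ^ 2) :
    (∃ z, Tendsto (waveAmplitude κ ψ) atTop (𝓝 z)) ∧
      ∃ z, Tendsto (waveAmplitude κ ψ) atBot (𝓝 z) := by
  obtain ⟨C, hC⟩ := hU.exists_norm_le hk hψ
  have hle := fun x => IsSchrodingerSolution.norm_deriv_waveAmplitude_le hκ (hU.nonneg x) (hC x)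
  exact ⟨exists_tendsto_of_norm_deriv_le (fun x => hψ.hasDerivAt_waveAmplitude hκ hsq x)
      hU.hasDerivAt hle hU.primitive_atTop,
    exists_tendsto_of_norm_deriv_le (fun x => hψ.hasDerivAt_waveAmplitude hκ hsq x)
      hU.hasDerivAt hle hU.primitive_atBot⟩

/-- The asymptotics of a solution determine the limits of its amplitudes. -/
theorem tendsto_waveAmplitude (hU : IsShortRange U Φ Φbot Φtop) (hk : 0 < k) {ψ : ℝ → ℂ}
    (hψ : IsSchrodingerSolution U k ψ) {a b : ℂ} {l : Filter ℝ} (hl : l = atTop ∨ l = atBot)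
    (h : Tendsto (fun x => ψ x - (a * planeWave k x + b * planeWave (-k) x)) l (𝓝 0)) :
    Tendsto (waveAmplitude k ψ) l (𝓝 a) ∧ Tendsto (waveAmplitude (-k) ψ) l (𝓝 b) := by
  have hne : l.NeBot := by rcases hl with rfl | rfl <;> infer_instance
  have hshift : ∀ τ : ℝ, Tendsto (fun x => x + τ) l l := by
    intro τ
    rcases hl with rfl | rfl
    · exact tendsto_atTop_add_const_right _ _ tendsto_id
    · exact tendsto_atBot_add_const_right _ _ tendsto_id
  obtain ⟨a', ha⟩ : ∃ z, Tendsto (waveAmplitude k ψ) l (𝓝 z) := by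
    have := hU.exists_tendsto_waveAmplitude hk hψ hk.ne' rfl
    rcases hl with rfl | rfl
    exacts [this.1, this.2]
  obtain ⟨b', hb⟩ : ∃ z, Tendsto (waveAmplitude (-k) ψ) l (𝓝 z) := by
    have := hU.exists_tendsto_waveAmplitude hk hψ (neg_ne_zero.2 hk.ne') (neg_sq k)
    rcases hl with rfl | rfl
    exacts [this.1, this.2]
  have h2 := tendsto_sub_planeWave (k := k) ha hb
  simp only [waveAmplitude_mul_planeWave_add hk.ne'] at h2
  have h3 := h.sub h2
  rw [sub_zero] at h3
  obtain ⟨e1, e2⟩ := planeWave_coeff_eq_zero hk (a := a' - a) (b := b' - b) hshift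
    (h3.congr fun x => by ring)
  rw [sub_eq_zero] at e1 e2
  exact ⟨e1 ▸ ha, e2 ▸ hb⟩

/-- Decay forces both amplitudes, hence the energy, to vanish at +∞; the uniform Grönwall bound
carries this back to every x. Uniqueness of the Jost solution follows. -/
theorem eq_zero_of_tendsto (hU : IsShortRange U Φ Φbot Φtop) (hk : 0 < k) {ψ : ℝ → ℂ}
    (hψ : IsSchrodingerSolution U k ψ) (h : Tendsto ψ atTop (𝓝 0)) (x : ℝ) : ψ x = 0 := by
  obtain ⟨ha, hb⟩ := hU.tendsto_waveAmplitude hk hψ (a := 0) (b := 0) (Or.inl rfl) (by simpa using h)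
  have hS : Tendsto (waveEnergy k ψ) atTop (𝓝 0) := by
    have := (ha.norm.pow 2).add (hb.norm.pow 2)
    simp only [sq_norm_waveAmplitude_add hk] at this
    simpa using this
  have hlim : Tendsto (fun y => Real.exp (|Φ x - Φ y| / k) * waveEnergy k ψ y) atTop
      (𝓝 (Real.exp (|Φ x - Φtop| / k) * 0)) :=
    ((((tendsto_const_nhds.sub hU.primitive_atTop).abs).div_const k).rexp).mul hS
  rw [mul_zero] at hlim
  have h0 : waveEnergy k ψ x ≤ 0 := ge_of_tendsto' hlim fun y =>
    hψ.waveEnergy_le_exp_mul hk hU.nonneg hU.hasDerivAt x y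
  rw [waveEnergy] at h0
  have h1 : 0 ≤ ‖deriv ψ x‖ ^ 2 / k := by positivity
  have h2 : k * ‖ψ x‖ ^ 2 ≤ 0 := by linarith
  have h3 : ‖ψ x‖ ^ 2 ≤ 0 := nonpos_of_mul_nonpos_right h2 hk
  simpa using h3

/-- A solution with prescribed Cauchy data at the origin. -/
theorem exists_solution (hU : IsShortRange U Φ Φbot Φtop) (k : ℝ) (z w : ℂ) :
    ∃ ψ, IsSchrodingerSolution U k ψ ∧ ψ 0 = z ∧ deriv ψ 0 = w := by
  obtain ⟨M, hM⟩ := hU.bounded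
  -- First-order system for (ψ, ψ') with coefficient matrix P + (U − k²)Q.
  let P : ℂ × ℂ →L[ℝ] ℂ × ℂ := (ContinuousLinearMap.snd ℝ ℂ ℂ).prod 0
  let Q : ℂ × ℂ →L[ℝ] ℂ × ℂ := (0 : ℂ × ℂ →L[ℝ] ℂ).prod (ContinuousLinearMap.fst ℝ ℂ ℂ)
  obtain ⟨X, hX0, hX⟩ := exists_forall_hasDerivAt_clm (A := fun t => P + (U t - k ^ 2) • Q)
    (continuous_const.add ((hU.continuous.sub continuous_const).smul continuous_const))
    (M := ‖P‖ + (M + k ^ 2) * ‖Q‖) (fun t => by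
      refine (norm_add_le _ _).trans ?_
      rw [norm_smul]
      gcongr
      rw [Real.norm_eq_abs, abs_le]
      constructor <;> nlinarith [hU.nonneg t, hM t, sq_nonneg k]) (z, w)
  have h1 : ∀ x, HasDerivAt (fun t => (X t).1) (X x).2 x := fun x => by
    refine ((ContinuousLinearMap.fst ℝ ℂ ℂ).hasFDerivAt.comp_hasDerivAt x (hX x)).congr_deriv ?_
    simp [P, Q]
  have h2 : ∀ x, HasDerivAt (fun t => (X t).2) (((U x - k ^ 2 : ℝ) : ℂ) * (X x).1) x := fun x => by
    refine ((ContinuousLinearMap.snd ℝ ℂ ℂ).hasFDerivAt.comp_hasDerivAt x (hX x)).congr_deriv ?_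
    simp [P, Q, sub_mul]
  refine ⟨fun t => (X t).1, .of_hasDerivAt h1 h2, by simp [hX0], ?_⟩
  rw [(h1 0).deriv, hX0]

/-- Amplitude limits, energy and flux of a Jost solution. -/
theorem jost_properties (hU : IsShortRange U Φ Φbot Φtop) (hk : 0 < k) {α β : ℂ} {J : ℝ → ℂ}
    (hJ : IsJostSolution U k α β J) :
    (∀ x, waveFlux J x = 1) ∧ Tendsto (waveEnergy k J) atTop (𝓝 1) ∧
      Tendsto (waveEnergy k J) atBot (𝓝 (‖α‖ ^ 2 + ‖β‖ ^ 2)) ∧ ‖α‖ ^ 2 - ‖β‖ ^ 2 = 1 := by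
  obtain ⟨h1, h2⟩ := hU.tendsto_waveAmplitude hk hJ.solution (a := 1) (b := 0) (Or.inl rfl)
    (by simpa using hJ.atTop)
  obtain ⟨h3, h4⟩ := hU.tendsto_waveAmplitude hk hJ.solution (Or.inr rfl) hJ.atBot
  have hflux : ∀ x, waveFlux J x = 1 := by
    intro x
    have := (h1.norm.pow 2).sub (h2.norm.pow 2)
    simp only [sq_norm_waveAmplitude_sub hk] at this
    have := tendsto_nhds_unique
      (this.congr fun y => hJ.solution.waveFlux_eq y x) tendsto_const_nhds
    simpa using this.symm
  refine ⟨hflux, ?_, ?_, ?_⟩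
  · have := (h1.norm.pow 2).add (h2.norm.pow 2)
    simp only [sq_norm_waveAmplitude_add hk] at this
    simpa using this
  · have := (h3.norm.pow 2).add (h4.norm.pow 2)
    simpa only [sq_norm_waveAmplitude_add hk] using this
  · have := (h3.norm.pow 2).sub (h4.norm.pow 2)
    simp only [sq_norm_waveAmplitude_sub hk, hflux] at this
    exact (tendsto_nhds_unique this tendsto_const_nhds)

/-- No equation is solved from infinity. The data (1, i) at the origin give flux 1, so the
amplitudes a, b at +∞ satisfy |a|² − |b|² = 1. Then āψ − bψ̄ has amplitudes |a|² − |b|² = 1 and āb −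
bā = 0 there. -/
theorem exists_jostSolution (hU : IsShortRange U Φ Φbot Φtop) (hk : 0 < k) :
    ∃ α β J, IsJostSolution U k α β J := by
  obtain ⟨ψ, hψ, hψ0, hψ1⟩ := hU.exists_solution k 1 Complex.I
  obtain ⟨⟨a, ha⟩, ⟨α, hα⟩⟩ := hU.exists_tendsto_waveAmplitude hk hψ hk.ne' rfl
  obtain ⟨⟨b, hb⟩, ⟨β, hβ⟩⟩ :=
    hU.exists_tendsto_waveAmplitude hk hψ (neg_ne_zero.2 hk.ne') (neg_sq k)
  have hab : ‖a‖ ^ 2 - ‖b‖ ^ 2 = 1 := by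
    have h := (ha.norm.pow 2).sub (hb.norm.pow 2)
    simp only [sq_norm_waveAmplitude_sub hk, hψ.waveFlux_eq _ 0] at h
    rw [tendsto_nhds_unique h tendsto_const_nhds, waveFlux, hψ0, hψ1]
    simp
  have hab' : conj a * a - b * conj b = 1 := by
    rw [mul_comm, Complex.mul_conj, Complex.mul_conj, ← Complex.sq_norm, ← Complex.sq_norm]
    exact_mod_cast congrArg Complex.ofReal hab
  have hc : Continuous (starRingEnd ℂ) := Complex.continuous_conj
  set J : ℝ → ℂ := fun t => conj a * ψ t + -b * conj (ψ t) with hJdef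
  have hJ : IsSchrodingerSolution U k J := hψ.linear hψ.conjugate _ _
  have hamp : ∀ κ, waveAmplitude κ J = fun x =>
      conj a * waveAmplitude κ ψ x + -b * conj (waveAmplitude (-κ) ψ x) := fun κ => by
    funext x
    rw [hJdef, waveAmplitude_linear κ hψ.differentiable hψ.conjugate.differentiable,
      waveAmplitude_conj κ hψ.differentiable]
  have hlim : ∀ {l : Filter ℝ} {p q : ℂ}, Tendsto (waveAmplitude k ψ) l (𝓝 p) →
      Tendsto (waveAmplitude (-k) ψ) l (𝓝 q) →
      Tendsto (fun x => J x - ((conj a * p + -b * conj q) * planeWave k x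
        + (conj a * q + -b * conj p) * planeWave (-k) x)) l (𝓝 0) := by
    intro l p q hp hq
    have h1 : Tendsto (waveAmplitude k J) l (𝓝 (conj a * p + -b * conj q)) := by
      rw [hamp]
      exact (hp.const_mul _).add (((hc.tendsto _).comp hq).const_mul _)
    have h2 : Tendsto (waveAmplitude (-k) J) l (𝓝 (conj a * q + -b * conj p)) := by
      rw [hamp, neg_neg]
      exact (hq.const_mul _).add (((hc.tendsto _).comp hp).const_mul _)
    have := tendsto_sub_planeWave (k := k) h1 h2
    simpa only [waveAmplitude_mul_planeWave_add hk.ne'] using this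
  refine ⟨_, _, J, hJ, ?_, hlim hα hβ⟩
  refine (hlim ha hb).congr fun x => ?_
  linear_combination -planeWave k x * hab'

theorem jost_unique (hU : IsShortRange U Φ Φbot Φtop) (hk : 0 < k) {α β α' β' : ℂ} {J J' : ℝ → ℂ}
    (hJ : IsJostSolution U k α β J) (hJ' : IsJostSolution U k α' β' J') : α = α' := by
  have h0 : ∀ x, 1 * J x + -1 * J' x = 0 :=
    hU.eq_zero_of_tendsto hk (hJ.solution.linear hJ'.solution 1 (-1)) (by
      have := hJ.atTop.sub hJ'.atTop
      rw [sub_zero] at this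
      exact this.congr fun x => by ring)
  have heq : J = J' := funext fun x => by linear_combination h0 x
  subst heq
  exact tendsto_nhds_unique (hU.tendsto_waveAmplitude hk hJ.solution (Or.inr rfl) hJ.atBot).1
    (hU.tendsto_waveAmplitude hk hJ'.solution (Or.inr rfl) hJ'.atBot).1

/-- The transmission probability of a short-range potential exists and is unique. -/
theorem existsUnique_transmissionProbability (hU : IsShortRange U Φ Φbot Φtop) (hk : 0 < k) :
    ∃! T, IsTransmissionProbability U k T := by
  obtain ⟨α, β, J, hJ⟩ := hU.exists_jostSolution hk
  have hα : α ≠ 0 := by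
    rintro rfl
    have := (hU.jost_properties hk hJ).2.2.2
    simp only [norm_zero] at this
    nlinarith [sq_nonneg ‖β‖]
  refine ⟨_, ⟨α, β, J, hJ, hα, rfl⟩, ?_⟩
  rintro T' ⟨α', β', J', hJ', -, rfl⟩
  rw [hU.jost_unique hk hJ hJ']

/-! ### Transmission bounds from the energy -/

theorem one_le_waveEnergy {ψ : ℝ → ℂ} {h x : ℝ} (hh : 0 < h) (hflux : waveFlux ψ x = 1) :
    1 ≤ waveEnergy h ψ x := by
  have := sq_waveEnergy hh ψ x
  rw [hflux] at this
  nlinarith [waveEnergy_nonneg hh ψ x, sq_nonneg ((‖deriv ψ x‖ ^ 2 / h - h * ‖ψ x‖ ^ 2) / 2),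
    sq_nonneg (inner ℝ (ψ x) (deriv ψ x))]

/-- Here |α|² + |β|² = 2|α|² − 1, while cosh 2θ = 2cosh²θ − 1. -/
theorem transmission_ge_of_energy_le {α β : ℂ} {θ : ℝ} (h1 : ‖α‖ ^ 2 - ‖β‖ ^ 2 = 1)
    (h2 : ‖α‖ ^ 2 + ‖β‖ ^ 2 ≤ Real.cosh (2 * θ)) : (1 / Real.cosh θ) ^ 2 ≤ ‖1 / α‖ ^ 2 := by
  have hα : ‖α‖ ^ 2 ≤ Real.cosh θ ^ 2 := by
    rw [Real.cosh_two_mul, Real.sinh_sq] at h2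
    linarith
  have hpos : 0 < ‖α‖ ^ 2 := by nlinarith [sq_nonneg ‖β‖]
  rw [norm_div, norm_one, div_pow, div_pow, one_pow]
  exact one_div_le_one_div_of_le hpos hα

/-- The `sech²` lower bound in terms of the integral of the potential. -/
theorem sech_sq_le_transmission (hU : IsShortRange U Φ Φbot Φtop) (hk : 0 < k) {T : ℝ}
    (hT : IsTransmissionProbability U k T) :
    (1 / Real.cosh ((Φtop - Φbot) / (2 * k))) ^ 2 ≤ T := by
  obtain ⟨α, β, J, hJ, -, rfl⟩ := hT
  obtain ⟨hflux, htop, hbot, hαβ⟩ := hU.jost_properties hk hJ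
  refine transmission_ge_of_energy_le hαβ ?_
  have hS : ∀ x, 1 ≤ waveEnergy k J x := fun x => one_le_waveEnergy hk (hflux x)
  have hmain : ∀ x y, x ≤ y → Real.arcosh (waveEnergy k J x)
      ≤ Real.arcosh (waveEnergy k J y) + (Φ y / k - Φ x / k) := by
    intro x y hxy
    refine arcosh_le_arcosh_add (g := fun t => Φ t / k) hxy
      (fun t _ => (hJ.solution.abs_deriv_waveEnergy_le hk (hU.nonneg t)).1)
      (fun t _ => (hU.hasDerivAt t).div_const k) (fun t _ => hS t)
      (fun t _ => div_nonneg (hU.nonneg t) hk.le) (fun t _ => ?_)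
    have := (hJ.solution.abs_deriv_waveEnergy_le hk (hU.nonneg t)).2
    rwa [hflux, one_pow] at this
  have hcont : Tendsto (fun y => Real.arcosh (waveEnergy k J y)) atTop (𝓝 0) := by
    rw [← Real.arcosh_zero]
    exact (Real.continuousOn_arcosh 1 Set.self_mem_Ici).tendsto.comp
      (tendsto_nhdsWithin_iff.2 ⟨htop, Eventually.of_forall hS⟩)
  have hx : ∀ x, Real.arcosh (waveEnergy k J x) ≤ 0 + (Φtop / k - Φ x / k) := fun x =>
    ge_of_tendsto (hcont.add ((hU.primitive_atTop.div_const k).sub_const _))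
      ((eventually_ge_atTop x).mono fun y hy => hmain x y hy)
  have hx' : ∀ x, waveEnergy k J x ≤ Real.cosh (0 + (Φtop / k - Φ x / k)) := fun x => by
    rw [← Real.cosh_arcosh (hS x), Real.cosh_le_cosh, abs_of_nonneg (Real.arcosh_nonneg (hS x))]
    exact (hx x).trans (le_abs_self _)
  have hlim : Tendsto (fun x => Real.cosh (0 + (Φtop / k - Φ x / k))) atBot
      (𝓝 (Real.cosh (0 + (Φtop / k - Φbot / k)))) :=
    (Real.continuous_cosh.tendsto _).comp
      (tendsto_const_nhds.add (tendsto_const_nhds.sub (hU.primitive_atBot.div_const k)))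
  refine (le_of_tendsto_of_tendsto' hbot hlim hx').trans (le_of_eq ?_)
  congr 1
  field_simp
  ring

/-- The lower bound for a single-peaked potential at energies above the peak. -/
theorem peak_le_transmission (hU : IsShortRange U Φ Φbot Φtop) (hk : 0 < k) {U' : ℝ → ℝ}
    (hd : ∀ x, HasDerivAt U (U' x) x) {p : ℝ} (hleft : ∀ x ≤ p, 0 ≤ U' x)
    (hright : ∀ x, p ≤ x → U' x ≤ 0) (hmax : ∀ x, U x ≤ U p) (hp : U p < k ^ 2) {T : ℝ}
    (hT : IsTransmissionProbability U k T) :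
    4 * k ^ 2 * (k ^ 2 - U p) / (2 * k ^ 2 - U p) ^ 2 ≤ T := by
  obtain ⟨α, β, J, hJ, -, rfl⟩ := hT
  obtain ⟨hflux, htop, hbot, hαβ⟩ := hU.jost_properties hk hJ
  set h : ℝ → ℝ := fun x => √(k ^ 2 - U x) with hh
  have hpos' : ∀ x, 0 < k ^ 2 - U x := fun x => by linarith [hmax x]
  have hpos : ∀ x, 0 < h x := fun x => Real.sqrt_pos.2 (hpos' x)
  have hsq : ∀ x, h x ^ 2 = k ^ 2 - U x := fun x => Real.sq_sqrt (hpos' x).le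
  have hle : ∀ x, h x ≤ k := fun x => Real.sqrt_le_iff.2 ⟨hk.le, by linarith [hU.nonneg x]⟩
  have hhd : ∀ x, HasDerivAt h (-U' x / (2 * h x)) x := fun x =>
    ((hd x).const_sub (k ^ 2)).sqrt (hpos' x).ne'
  have hlog : ∀ x, HasDerivAt (fun t => Real.log (h t)) (-U' x / (2 * h x) / h x) x := fun x =>
    (hhd x).log (hpos x).ne'
  have hS : ∀ x, 1 ≤ waveEnergy (h x) J x := fun x => one_le_waveEnergy (hpos x) (hflux x)
  have hSd : ∀ x, HasDerivAt (fun t => waveEnergy (h t) J t) (-(-U' x / (2 * h x) / h x *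
      ((‖deriv J x‖ ^ 2 / h x - h x * ‖J x‖ ^ 2) / 2))) x := fun x => by
    refine (hJ.solution.hasDerivAt_waveEnergy (hhd x) (hpos x)).congr_deriv ?_
    have : h x + (U x - k ^ 2) / h x = 0 := by
      rw [show U x - k ^ 2 = -h x ^ 2 by rw [hsq]; ring]
      have := (hpos x).ne'
      field_simp
      ring
    rw [this]
    ring
  have hD : ∀ x, |(‖deriv J x‖ ^ 2 / h x - h x * ‖J x‖ ^ 2) / 2|
      ≤ √(waveEnergy (h x) J x ^ 2 - 1) := fun x => by
    refine Real.abs_le_sqrt ?_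
    rw [sq_waveEnergy (hpos x), hflux]
    nlinarith [sq_nonneg (inner ℝ (J x) (deriv J x))]
  -- h decreases up to p and increases afterwards, so |h'|/h is the derivative of −log h on the left
  -- and of log h on the right.
  have hL : ∀ x ≤ p, Real.arcosh (waveEnergy (h x) J x)
      ≤ Real.arcosh (waveEnergy (h p) J p) + (-Real.log (h p) - -Real.log (h x)) := by
    intro x hx
    have hg : ∀ t ∈ Set.Icc x p, 0 ≤ -(-U' t / (2 * h t) / h t) := fun t ht => by
      have := hleft t ht.2
      have := hpos t
      rw [neg_div, neg_div, neg_neg]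
      positivity
    refine arcosh_le_arcosh_add (S := fun t => waveEnergy (h t) J t)
      (g := fun t => -Real.log (h t)) hx (fun t _ => hSd t)
      (fun t _ => (hlog t).neg) (fun t _ => hS t) hg (fun t ht => ?_)
    rw [← neg_mul, abs_mul, abs_of_nonneg (hg t ht)]
    exact mul_le_mul_of_nonneg_left (hD t) (hg t ht)
  have hR : ∀ y, p ≤ y → Real.arcosh (waveEnergy (h p) J p)
      ≤ Real.arcosh (waveEnergy (h y) J y) + (Real.log (h y) - Real.log (h p)) := by
    intro y hy
    have hg : ∀ t ∈ Set.Icc p y, 0 ≤ -U' t / (2 * h t) / h t := fun t ht => by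
      have : 0 ≤ -U' t := neg_nonneg.2 (hright t ht.1)
      have := hpos t
      positivity
    refine arcosh_le_arcosh_add (S := fun t => waveEnergy (h t) J t)
      (g := fun t => Real.log (h t)) hy (fun t _ => hSd t)
      (fun t _ => hlog t) (fun t _ => hS t) hg (fun t ht => ?_)
    rw [abs_neg, abs_mul, abs_of_nonneg (hg t ht)]
    exact mul_le_mul_of_nonneg_left (hD t) (hg t ht)
  have hlim : ∀ {l : Filter ℝ}, Tendsto U l (𝓝 0) → Tendsto h l (𝓝 k) := by
    intro l hl
    have := (hl.const_sub (k ^ 2)).sqrt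
    rwa [sub_zero, Real.sqrt_sq hk.le] at this
  have hhtop := hlim hU.tendsto_atTop
  have hhbot := hlim hU.tendsto_atBot
  -- The energies relative to h and k differ by a factor of at most k/h, which tends to 1.
  have hStop : Tendsto (fun y => waveEnergy (h y) J y) atTop (𝓝 1) := by
    have h1 := ((tendsto_const_nhds (x := k)).div hhtop hk.ne').mul htop
    rw [div_self hk.ne', one_mul] at h1
    exact tendsto_of_tendsto_of_tendsto_of_le_of_le tendsto_const_nhds h1 hS
      fun y => (waveEnergy_le_div_mul (hpos y) (hle y) J y).1
  have hcont : Tendsto (fun y => Real.arcosh (waveEnergy (h y) J y)) atTop (𝓝 0) := by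
    rw [← Real.arcosh_zero]
    exact (Real.continuousOn_arcosh 1 Set.self_mem_Ici).tendsto.comp
      (tendsto_nhdsWithin_iff.2 ⟨hStop, Eventually.of_forall hS⟩)
  have hpeak : Real.arcosh (waveEnergy (h p) J p) ≤ 0 + (Real.log k - Real.log (h p)) :=
    ge_of_tendsto (hcont.add ((hhtop.log hk.ne').sub_const _))
      ((eventually_ge_atTop p).mono hR)
  have hx : ∀ x ≤ p, waveEnergy k J x ≤ k / h x *
      Real.cosh (Real.log k + Real.log (h x) - 2 * Real.log (h p)) := by
    intro x hx
    refine (waveEnergy_le_div_mul (hpos x) (hle x) J x).2.trans ?_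
    refine mul_le_mul_of_nonneg_left ?_ (div_pos hk (hpos x)).le
    rw [← Real.cosh_arcosh (hS x), Real.cosh_le_cosh, abs_of_nonneg (Real.arcosh_nonneg (hS x))]
    refine le_trans ?_ (le_abs_self _)
    linarith [hL x hx]
  have hxlim : Tendsto (fun x => k / h x *
      Real.cosh (Real.log k + Real.log (h x) - 2 * Real.log (h p))) atBot
      (𝓝 (k / k * Real.cosh (Real.log k + Real.log k - 2 * Real.log (h p)))) :=
    ((tendsto_const_nhds (x := k)).div hhbot hk.ne').mul ((Real.continuous_cosh.tendsto _).comp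
      ((tendsto_const_nhds.add (hhbot.log hk.ne')).sub_const _))
  have hfin := le_of_tendsto_of_tendsto hbot hxlim ((eventually_le_atBot p).mono hx)
  refine le_trans (le_of_eq ?_) (transmission_ge_of_energy_le (θ := Real.log (k / h p)) hαβ ?_)
  · have h2 := (hpos p).ne'
    rw [Real.cosh_log (div_pos hk (hpos p)), ← hsq p,
      show 2 * k ^ 2 - U p = k ^ 2 + h p ^ 2 by rw [hsq]; ring]
    have : k ^ 2 + h p ^ 2 ≠ 0 := by positivity
    field_simp
    ring
  · refine hfin.trans (le_of_eq ?_)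
    rw [div_self hk.ne', one_mul, Real.log_div hk.ne' (hpos p).ne']
    congr 1
    ring

end IsShortRange

/-! ### The inverse tortoise coordinate -/

theorem areaRadius_tortoise {m : ℝ} (hm : 0 < m) {r : ℝ} (hr : 2 * m < r) :
    areaRadius m (tortoise m r) = r :=
  (tortoise_strictMonoOn hm).injOn (areaRadius_gt hm _) hr (tortoise_areaRadius hm _)

theorem areaRadius_strictMono {m : ℝ} (hm : 0 < m) : StrictMono (areaRadius m) := by
  intro x y hxy
  rwa [← (tortoise_strictMonoOn hm).lt_iff_lt (areaRadius_gt hm x) (areaRadius_gt hm y),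
    tortoise_areaRadius hm, tortoise_areaRadius hm]

/-- The logarithmic part of `tortoise` is increasing, so `tortoise` does not shrink distances and
its inverse is 1-Lipschitz. -/
theorem areaRadius_sub_le {m : ℝ} (hm : 0 < m) {x y : ℝ} (hxy : x ≤ y) :
    areaRadius m y - areaRadius m x ≤ y - x := by
  have hx := areaRadius_gt hm x
  have hmono := (areaRadius_strictMono hm).monotone hxy
  have h1 : Real.log ((areaRadius m x - 2 * m) / (2 * m))
      ≤ Real.log ((areaRadius m y - 2 * m) / (2 * m)) :=
    Real.log_le_log (div_pos (by linarith) (by linarith)) (by gcongr)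
  have h2 := mul_le_mul_of_nonneg_left h1 (show 0 ≤ 2 * m by linarith)
  have ex := tortoise_areaRadius hm x
  have ey := tortoise_areaRadius hm y
  rw [tortoise] at ex ey
  linarith

theorem continuous_areaRadius {m : ℝ} (hm : 0 < m) : Continuous (areaRadius m) := by
  refine (LipschitzWith.of_dist_le_mul (K := 1) fun x y => ?_).continuous
  rw [NNReal.coe_one, one_mul, Real.dist_eq, Real.dist_eq]
  have hmono := (areaRadius_strictMono hm).monotone
  rcases le_total x y with h | h
  · rw [abs_sub_comm, abs_of_nonneg (sub_nonneg.2 (hmono h)), abs_sub_comm,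
      abs_of_nonneg (sub_nonneg.2 h)]
    exact areaRadius_sub_le hm h
  · rw [abs_of_nonneg (sub_nonneg.2 (hmono h)), abs_of_nonneg (sub_nonneg.2 h)]
    exact areaRadius_sub_le hm h

theorem hasDerivAt_areaRadius {m : ℝ} (hm : 0 < m) (x : ℝ) :
    HasDerivAt (areaRadius m) (1 - 2 * m / areaRadius m x) x := by
  have hr := areaRadius_gt hm x
  set r := areaRadius m x with hrdef
  have hr0 : 0 < r := by linarith
  have hd : HasDerivAt (tortoise m) (1 + 2 * m * (1 / (2 * m) / ((r - 2 * m) / (2 * m)))) r :=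
    (hasDerivAt_id r).add (((((hasDerivAt_id r).sub_const (2 * m)).div_const (2 * m)).log
      (div_pos (by simpa using hr) (by linarith)).ne').const_mul (2 * m))
  have e : 1 + 2 * m * (1 / (2 * m) / ((r - 2 * m) / (2 * m))) = r / (r - 2 * m) := by
    have : r - 2 * m ≠ 0 := by linarith
    field_simp
    ring
  rw [e] at hd
  have h := HasDerivAt.of_local_left_inverse (continuous_areaRadius hm).continuousAt hd
    (div_pos hr0 (by linarith)).ne' (Eventually.of_forall (tortoise_areaRadius hm))
  refine h.congr_deriv ?_
  rw [inv_div]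
  field_simp

theorem tendsto_areaRadius_atTop {m : ℝ} (hm : 0 < m) : Tendsto (areaRadius m) atTop atTop := by
  refine tendsto_atTop.2 fun R => ?_
  have hR : 2 * m < max R (2 * m + 1) := lt_max_of_lt_right (by linarith)
  filter_upwards [eventually_ge_atTop (tortoise m (max R (2 * m + 1)))] with x hx
  have := (areaRadius_strictMono hm).monotone hx
  rw [areaRadius_tortoise hm hR] at this
  exact (le_max_left _ _).trans this

theorem tendsto_areaRadius_atBot {m : ℝ} (hm : 0 < m) :
    Tendsto (areaRadius m) atBot (𝓝 (2 * m)) := by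
  refine tendsto_order.2 ⟨fun a ha => Eventually.of_forall fun x => ha.trans (areaRadius_gt hm x),
    fun a ha => ?_⟩
  filter_upwards [eventually_lt_atBot (tortoise m a)] with x hx
  have := areaRadius_strictMono hm hx
  rwa [areaRadius_tortoise hm ha] at this

/-! ### Shape and integral of the Regge–Wheeler potential -/

theorem hasDerivAt_reggeWheelerV (m ℓ s : ℝ) {r : ℝ} (hr : r ≠ 0) :
    HasDerivAt (reggeWheelerV m ℓ s)
      (-(2 * (ℓ * (ℓ + 1)) * r ^ 2 + 6 * m * ((1 - s ^ 2) - ℓ * (ℓ + 1)) * r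
        - 16 * m ^ 2 * (1 - s ^ 2)) / r ^ 5) r := by
  have h1 : HasDerivAt (fun r : ℝ => 1 - 2 * m / r) (-((0 * r - 2 * m * 1) / r ^ 2)) r :=
    ((hasDerivAt_const r (2 * m)).div (hasDerivAt_id r) hr).const_sub 1
  have hp : ∀ n : ℕ, HasDerivAt (fun r : ℝ => r ^ n) (n * r ^ (n - 1)) r := fun n =>
    hasDerivAt_pow n r
  have h2 := (hasDerivAt_const r (ℓ * (ℓ + 1))).div (hp 2) (pow_ne_zero 2 hr)
  have h3 := (hasDerivAt_const r (2 * m * (1 - s ^ 2))).div (hp 3) (pow_ne_zero 3 hr)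
  refine (h1.mul (h2.add h3)).congr_deriv ?_
  simp only [Pi.add_apply, Pi.div_apply]
  field_simp
  push_cast
  ring

/-- For s > 1 the term 1 − s² is negative; s ≤ ℓ still gives ℓ(ℓ+1) + 1 − s² ≥ 1, and r > 2m does
the rest. -/
theorem reggeWheelerV_pos {m ℓ s : ℝ} (hm : 0 < m) (hs : 0 ≤ s) (hℓ : s ≤ ℓ) {r : ℝ}
    (hr : 2 * m < r) : 0 < reggeWheelerV m ℓ s r := by
  have hr0 : 0 < r := by linarith
  have hA : 0 ≤ ℓ * (ℓ + 1) := by nlinarith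
  have hAB : 1 ≤ ℓ * (ℓ + 1) + (1 - s ^ 2) := by nlinarith
  have e : reggeWheelerV m ℓ s r
      = (r - 2 * m) * (ℓ * (ℓ + 1) * r + 2 * m * (1 - s ^ 2)) / r ^ 4 := by
    rw [reggeWheelerV]
    field_simp
  rw [e]
  have : 0 < ℓ * (ℓ + 1) * r + 2 * m * (1 - s ^ 2) := by nlinarith
  have : 0 < r - 2 * m := by linarith
  positivity

/-- The Regge–Wheeler potential has a single critical point in the exterior, where its slope
changes sign. -/
theorem exists_reggeWheelerV_slope {m ℓ s : ℝ} (hm : 0 < m) (hs : 0 ≤ s) (hℓ : s ≤ ℓ) :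
    ∃ r₀, 2 * m < r₀ ∧ ∀ r, 2 * m < r →
      ∃ c, 0 < c ∧ HasDerivAt (reggeWheelerV m ℓ s) (c * (r₀ - r)) r := by
  have hA : 0 ≤ ℓ * (ℓ + 1) := by nlinarith
  have hAB : 1 ≤ ℓ * (ℓ + 1) + (1 - s ^ 2) := by nlinarith
  have hderiv := fun r => hasDerivAt_reggeWheelerV m ℓ s (r := r)
  generalize ℓ * (ℓ + 1) = A at hA hAB hderiv
  generalize 1 - s ^ 2 = B at hAB hderiv
  -- The quadratic equals −4m²(A + B) < 0 at 2m and 8m²(A + B) > 0 at 4m.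
  obtain ⟨r₀, ⟨h1, -⟩, h0⟩ : ∃ r ∈ Set.Icc (2 * m) (4 * m),
      2 * A * r ^ 2 + 6 * m * (B - A) * r - 16 * m ^ 2 * B = 0 := by
    refine intermediate_value_Icc (by linarith)
      (f := fun r => 2 * A * r ^ 2 + 6 * m * (B - A) * r - 16 * m ^ 2 * B)
      (Continuous.continuousOn (by fun_prop)) ⟨?_, ?_⟩ <;>
    nlinarith [mul_pos hm hm]
  have hr0 : 2 * m < r₀ := by
    refine lt_of_le_of_ne h1 ?_
    rintro rfl
    nlinarith [mul_pos hm hm]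
  have hr0' : 0 < r₀ := by linarith
  -- B may be negative, so this sign must be extracted from the equation for r₀. Up to the factor 4
  -- it is the numerator of c at r = 2m.
  have hkey : 0 < m * (A * r₀ + 4 * m * B) := by
    have : (r₀ - 2 * m) * (4 * (m * (A * r₀ + 4 * m * B))) = r₀ * (4 * m ^ 2 * (A + B)) := by
      linear_combination 2 * m * h0
    refine pos_of_mul_pos_right (a := 4)
      (pos_of_mul_pos_right (a := r₀ - 2 * m) ?_ (by linarith)) (by norm_num)
    rw [this]
    have : 0 < A + B := by linarith
    positivity
  -- Dividing the quadratic by r − r₀ leaves 2Ar + 16m²B/r₀, which gives c.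
  refine ⟨r₀, hr0, fun r hr => ⟨(2 * A * r * r₀ + 16 * m ^ 2 * B) / (r₀ * r ^ 5), ?_, ?_⟩⟩
  · have hr' : 0 < r := by linarith
    refine div_pos ?_ (by positivity)
    nlinarith [mul_nonneg (mul_nonneg hA hr0'.le) (sub_nonneg.2 hr.le)]
  · have hr' : 0 < r := by linarith
    refine (hderiv r hr'.ne').congr_deriv ?_
    field_simp
    linear_combination (-r) * h0

theorem lt_of_slope_sign {f : ℝ → ℝ} {a r₀ : ℝ} (h0 : a < r₀)
    (hf : ∀ r, a < r → ∃ c, 0 < c ∧ HasDerivAt f (c * (r₀ - r)) r) {r : ℝ} (hr : a < r)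
    (hne : r ≠ r₀) : f r < f r₀ := by
  rcases lt_or_gt_of_ne hne with h | h
  · have hm : StrictMonoOn f (Set.Icc r r₀) := by
      refine strictMonoOn_of_deriv_pos (convex_Icc _ _) (fun t ht => ?_) fun t ht => ?_
      · obtain ⟨c, -, hd⟩ := hf t (hr.trans_le ht.1)
        exact hd.continuousAt.continuousWithinAt
      · rw [interior_Icc] at ht
        obtain ⟨c, hc, hd⟩ := hf t (hr.trans ht.1)
        rw [hd.deriv]
        exact mul_pos hc (sub_pos.2 ht.2)
    exact hm ⟨le_rfl, h.le⟩ ⟨h.le, le_rfl⟩ h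
  · have hm : StrictAntiOn f (Set.Icc r₀ r) := by
      refine strictAntiOn_of_deriv_neg (convex_Icc _ _) (fun t ht => ?_) fun t ht => ?_
      · obtain ⟨c, -, hd⟩ := hf t (h0.trans_le ht.1)
        exact hd.continuousAt.continuousWithinAt
      · rw [interior_Icc] at ht
        obtain ⟨c, hc, hd⟩ := hf t (h0.trans ht.1)
        rw [hd.deriv]
        exact mul_neg_of_pos_of_neg hc (sub_neg.2 ht.1)
    exact hm ⟨le_rfl, h.le⟩ ⟨h.le, le_rfl⟩ h

theorem reggeWheelerPeak_eq {m ℓ s r : ℝ} (hr : 2 * m < r)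
    (hmax : IsMaxOn (reggeWheelerV m ℓ s) (Set.Ioi (2 * m)) r) :
    reggeWheelerPeak m ℓ s = reggeWheelerV m ℓ s r :=
  IsGreatest.csSup_eq ⟨Set.mem_image_of_mem _ hr, by rintro _ ⟨t, ht, rfl⟩; exact hmax ht⟩

/-- Since dr/dr_* = 1 − 2m/r, the antiderivative in r_* is that of the bracket ℓ(ℓ+1)/r² + 2m(1 −
s²)/r³ in r. -/
theorem isShortRange_reggeWheelerV {m ℓ s : ℝ} (hm : 0 < m) (hs : 0 ≤ s) (hℓ : s ≤ ℓ) :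
    IsShortRange (fun x => reggeWheelerV m ℓ s (areaRadius m x))
      (fun x => -(ℓ * (ℓ + 1)) / areaRadius m x - m * (1 - s ^ 2) / areaRadius m x ^ 2)
      (-(ℓ * (ℓ + 1)) / (2 * m) - m * (1 - s ^ 2) / (2 * m) ^ 2) 0 := by
  obtain ⟨r₀, h0, hslope⟩ := exists_reggeWheelerV_slope hm hs hℓ
  have hne : ∀ x, areaRadius m x ≠ 0 := fun x => by linarith [areaRadius_gt hm x]
  have hinv : Tendsto (fun x => (areaRadius m x)⁻¹) atTop (𝓝 0) :=
    tendsto_inv_atTop_zero.comp (tendsto_areaRadius_atTop hm)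
  refine ⟨?_, fun x => (reggeWheelerV_pos hm hs hℓ (areaRadius_gt hm x)).le,
    ⟨reggeWheelerV m ℓ s r₀, fun x => ?_⟩, fun x => ?_, ?_, ?_, ?_, ?_⟩
  · refine continuous_iff_continuousAt.2 fun x => ?_
    exact ContinuousAt.comp (g := reggeWheelerV m ℓ s)
      (hasDerivAt_reggeWheelerV m ℓ s (hne x)).continuousAt
      (continuous_areaRadius hm).continuousAt
  · by_cases h : areaRadius m x = r₀
    · rw [h]
    · exact (lt_of_slope_sign h0 hslope (areaRadius_gt hm x) h).le
  · have hd := hasDerivAt_areaRadius hm x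
    have h1 := (hasDerivAt_const x (-(ℓ * (ℓ + 1)))).div hd (hne x)
    have h2 := (hasDerivAt_const x (m * (1 - s ^ 2))).div (hd.pow 2) (pow_ne_zero 2 (hne x))
    refine (h1.sub h2).congr_deriv ?_
    have := hne x
    rw [reggeWheelerV]
    simp only [Pi.pow_apply]
    field_simp
    push_cast
    ring
  · have h : Tendsto (fun v : ℝ => (1 - 2 * m * v) *
        (ℓ * (ℓ + 1) * v ^ 2 + 2 * m * (1 - s ^ 2) * v ^ 3)) (𝓝 0) (𝓝 0) :=
      Continuous.tendsto' (by fun_prop) _ _ (by simp)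
    refine (h.comp hinv).congr fun x => ?_
    simp only [Function.comp_apply, reggeWheelerV, div_eq_mul_inv, inv_pow]
  -- The formula for V is regular at the horizon r = 2m and vanishes there.
  · have h := (hasDerivAt_reggeWheelerV m ℓ s (r := 2 * m) (by positivity)).continuousAt.tendsto
    have e : reggeWheelerV m ℓ s (2 * m) = 0 := by
      rw [reggeWheelerV, div_self (by positivity)]
      simp
    rw [e] at h
    exact h.comp (tendsto_areaRadius_atBot hm)
  · have h : Tendsto (fun v : ℝ => -(ℓ * (ℓ + 1)) * v - m * (1 - s ^ 2) * v ^ 2) (𝓝 0) (𝓝 0) :=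
      Continuous.tendsto' (by fun_prop) _ _ (by simp)
    refine (h.comp hinv).congr fun x => ?_
    simp only [Function.comp_apply, div_eq_mul_inv, inv_pow]
  · have h := tendsto_areaRadius_atBot hm
    have hm2 : (2 * m) ≠ 0 := by positivity
    exact (tendsto_const_nhds.div h hm2).sub (tendsto_const_nhds.div (h.pow 2) (pow_ne_zero 2 hm2))

/-! ### Greybody factor bounds -/

theorem reggeWheelerPeak_le_greybodyFactor {m ℓ s ω T : ℝ} (hm : 0 < m) (hω : 0 < ω) (hs : 0 ≤ s)
    (hℓ : s ≤ ℓ) (hT : IsGreybodyFactor m ℓ s ω T) (hpeak : reggeWheelerPeak m ℓ s < ω ^ 2) :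
    4 * ω ^ 2 * (ω ^ 2 - reggeWheelerPeak m ℓ s) / (2 * ω ^ 2 - reggeWheelerPeak m ℓ s) ^ 2
      ≤ T := by
  obtain ⟨r₀, h0, hslope⟩ := exists_reggeWheelerV_slope hm hs hℓ
  have hmax : ∀ r, 2 * m < r → reggeWheelerV m ℓ s r ≤ reggeWheelerV m ℓ s r₀ := fun r hr => by
    by_cases h : r = r₀
    · rw [h]
    · exact (lt_of_slope_sign h0 hslope hr h).le
  have hr₀ := areaRadius_tortoise hm h0
  rw [reggeWheelerPeak_eq h0 hmax, ← hr₀] at hpeak ⊢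
  choose! c hc hd using hslope
  have hf : ∀ x, 0 ≤ 1 - 2 * m / areaRadius m x := fun x => by
    have := areaRadius_gt hm x
    rw [sub_nonneg, div_le_one (by linarith)]
    exact this.le
  have hmono := (areaRadius_strictMono hm).monotone
  refine (isShortRange_reggeWheelerV hm hs hℓ).peak_le_transmission hω
    (U' := fun x => c (areaRadius m x) * (r₀ - areaRadius m x) * (1 - 2 * m / areaRadius m x))
    (fun x => (hd _ (areaRadius_gt hm x)).comp x (hasDerivAt_areaRadius hm x))
    (p := tortoise m r₀) (fun x hx => ?_) (fun x hx => ?_) (fun x => ?_) hpeak hT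
  · refine mul_nonneg (mul_nonneg (hc _ (areaRadius_gt hm x)).le (sub_nonneg.2 ?_)) (hf x)
    exact (hmono hx).trans_eq hr₀
  · refine mul_nonpos_of_nonpos_of_nonneg
      (mul_nonpos_of_nonneg_of_nonpos (hc _ (areaRadius_gt hm x)).le (sub_nonpos.2 ?_)) (hf x)
    exact hr₀.symm.trans_le (hmono hx)
  · rw [hr₀]
    exact hmax _ (areaRadius_gt hm x)

theorem isMaxOn_reggeWheelerV_spin_one {m ℓ : ℝ} (hm : 0 < m) (hℓ : 1 ≤ ℓ) :
    IsMaxOn (reggeWheelerV m ℓ 1) (Set.Ioi (2 * m)) (3 * m) := by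
  intro r hr
  have hr' : 2 * m < r := hr
  have hr0 : 0 < r := by linarith
  have h1 : reggeWheelerV m ℓ 1 r = ℓ * (ℓ + 1) * ((r - 2 * m) / r ^ 3) := by
    rw [reggeWheelerV]
    field_simp
    ring
  have h2 : reggeWheelerV m ℓ 1 (3 * m) = ℓ * (ℓ + 1) * (1 / (27 * m ^ 2)) := by
    rw [reggeWheelerV]
    field_simp
    ring
  change reggeWheelerV m ℓ 1 r ≤ reggeWheelerV m ℓ 1 (3 * m)
  rw [h1, h2]
  refine mul_le_mul_of_nonneg_left ?_ (by positivity)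
  rw [div_le_div_iff₀ (by positivity) (by positivity)]
  -- r³ − 27m²(r − 2m) = (r − 3m)²(r + 6m).
  nlinarith [mul_nonneg (sq_nonneg (r - 3 * m)) (show 0 ≤ r + 6 * m by linarith)]

theorem mainTheorem5 (m ω ℓ s : ℝ) (hm : 0 < m) (hω : 0 < ω) (hs : 0 ≤ s) (hℓ : s ≤ ℓ) :
    (∃! r : ℝ, r ∈ Set.Ioi (2 * m) ∧
        IsMaxOn (reggeWheelerV m ℓ s) (Set.Ioi (2 * m)) r) ∧
    ∃ T : ℝ, IsGreybodyFactor m ℓ s ω T ∧ (∀ T' : ℝ, IsGreybodyFactor m ℓ s ω T' → T' = T) ∧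
      T ≥ (1 / Real.cosh (((ℓ + 1) ^ 2 + (ℓ ^ 2 - s ^ 2)) / (8 * ω * m))) ^ 2 ∧
      (ω ^ 2 > reggeWheelerPeak m ℓ s →
        T ≥ 4 * ω ^ 2 * (ω ^ 2 - reggeWheelerPeak m ℓ s)
              / (2 * ω ^ 2 - reggeWheelerPeak m ℓ s) ^ 2 ∧
        4 * ω ^ 2 * (ω ^ 2 - reggeWheelerPeak m ℓ s)
              / (2 * ω ^ 2 - reggeWheelerPeak m ℓ s) ^ 2
          = 1 - reggeWheelerPeak m ℓ s ^ 2 / (2 * ω ^ 2 - reggeWheelerPeak m ℓ s) ^ 2) ∧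
      (s = 1 →
        IsMaxOn (reggeWheelerV m ℓ s) (Set.Ioi (2 * m)) (3 * m) ∧
        reggeWheelerPeak m ℓ s = ℓ * (ℓ + 1) / (27 * m ^ 2) ∧
        (ω ^ 2 > reggeWheelerPeak m ℓ s →
          T ≥ 108 * ω ^ 2 * m ^ 2 * (27 * ω ^ 2 * m ^ 2 - ℓ * (ℓ + 1))
                / (54 * ω ^ 2 * m ^ 2 - ℓ * (ℓ + 1)) ^ 2)) := by
  obtain ⟨r₀, h0, hslope⟩ := exists_reggeWheelerV_slope hm hs hℓ
  have hlt : ∀ r, 2 * m < r → r ≠ r₀ → reggeWheelerV m ℓ s r < reggeWheelerV m ℓ s r₀ :=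
    fun r hr hne => lt_of_slope_sign h0 hslope hr hne
  have hmax : IsMaxOn (reggeWheelerV m ℓ s) (Set.Ioi (2 * m)) r₀ := fun r hr => by
    by_cases h : r = r₀
    · exact (congrArg (reggeWheelerV m ℓ s) h).le
    · exact (hlt r hr h).le
  have hU := isShortRange_reggeWheelerV hm hs hℓ
  refine ⟨⟨r₀, ⟨h0, hmax⟩, fun r hr => ?_⟩, ?_⟩
  · by_contra hne
    exact absurd (hr.2 h0) (not_le.2 (hlt r hr.1 hne))
  obtain ⟨T, hT, huniq⟩ := hU.existsUnique_transmissionProbability hω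
  refine ⟨T, hT, huniq, ?_, fun hpeak => ⟨?_, ?_⟩, ?_⟩
  -- The total integral is (2ℓ(ℓ+1) + 1 − s²)/(4m), and 2ℓ(ℓ+1) + 1 = (ℓ+1)² + ℓ².
  · convert hU.sech_sq_le_transmission hω hT using 4
    field_simp
    ring
  · exact reggeWheelerPeak_le_greybodyFactor hm hω hs hℓ hT hpeak
  · have : 2 * ω ^ 2 - reggeWheelerPeak m ℓ s ≠ 0 := by nlinarith [sq_nonneg ω]
    rw [one_sub_div (pow_ne_zero 2 this)]
    congr 1
    ring
  · rintro rfl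
    have hmax3 := isMaxOn_reggeWheelerV_spin_one hm hℓ
    have hp : reggeWheelerPeak m ℓ 1 = ℓ * (ℓ + 1) / (27 * m ^ 2) := by
      rw [reggeWheelerPeak_eq (by linarith) hmax3, reggeWheelerV]
      field_simp
      ring
    refine ⟨hmax3, hp, fun hpeak => ?_⟩
    refine le_trans (le_of_eq ?_) (reggeWheelerPeak_le_greybodyFactor hm hω hs hℓ hT hpeak)
    rw [hp] at hpeak ⊢
    have h1 : ω ^ 2 - ℓ * (ℓ + 1) / (27 * m ^ 2)
        = (27 * ω ^ 2 * m ^ 2 - ℓ * (ℓ + 1)) / (27 * m ^ 2) := by field_simp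
    have h2 : 2 * ω ^ 2 - ℓ * (ℓ + 1) / (27 * m ^ 2)
        = (54 * ω ^ 2 * m ^ 2 - ℓ * (ℓ + 1)) / (27 * m ^ 2) := by field_simp; ring
    have h3 : 54 * ω ^ 2 * m ^ 2 - ℓ * (ℓ + 1) ≠ 0 := by
      have : 0 < ω ^ 2 - ℓ * (ℓ + 1) / (27 * m ^ 2) := by linarith
      rw [h1, div_pos_iff_of_pos_right (by positivity)] at this
      nlinarith [mul_pos hω hm]
    rw [h1, h2]
    field_simp
    ring
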